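/- \textbf{Definitions.} A commutative residuated lattice (CRL) is an algebra $(A,\wedge,\vee,\cdot,\to,t)$ such that $(A,\wedge,\vee)$ is a lattice, $(A,\cdot,t)$ is a commutative monoid, and $a\cdot b\le c\iff a\le b\to c$. A \emph{Sugihara monoid} is a CRL whose lattice is distributive, which satisfies $x\cdot x=x$, and which is equipped with a unary operation $\neg$ satisfying $\neg\neg x=x$ and $x\to\neg y=y\to\neg x$. A \emph{relative Stone algebra} is a CRL $(A,\wedge,\vee,\to,t)$ with $\cdot=\wedge$ (a Brouwerian algebra) that is a subdirect product of totally ordered ones. Let $\mathsf{SM}$ be the category of Sugihara monoids and $\mathsf{bRSA}$ the category of relative Stone algebras with a designated constant $f$ satisfying $a\vee(a\to f)=t$ for all $a$ (bRS-algebras); morphisms are the homomorphisms in the full signatures. Let $\mathsf{SM}_\bot$ and $\mathsf{bGA}$ be the categories of objects of $\mathsf{SM}$, respectively $\mathsf{bRSA}$, expanded by a constant $\bot$ denoting a least element, with the homomorphisms that also preserve $\bot$. For a Sugihara monoid $\mathbf A$, let $\mathbf A_{\bowtie}$ be its negative cone $A^-=\{a\in A: a\le t\}$ with the operations $\wedge,\vee$,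 $a\to^- b=(a\to b)\wedge t$, top element $t$ (on $A^-$ the operations $\cdot$ and $\wedge$ coincide), and designated constant $f=\neg t$; for a homomorphism $h\colon\mathbf A\to\mathbf B$ let $h_{\bowtie}=h\restriction_{A^-}$. For a bRS-algebra $\mathbf A$, write $Na=f\to a$ and put $$A^{\bowtie}=\{\langle a,b\rangle\in A^2: a\vee b=t,\ a\wedge b\le f\},\qquad \Sigma(\mathbf A)=\{\langle a,b\rangle\in A^2: a\vee b=t,\ Nb=b\},$$ both with the lattice operations $\langle a,b\rangle\sqcap\langle c,d\rangle=\langle a\wedge c,b\vee d\rangle$ and $\langle a,b\rangle\sqcup\langle c,d\rangle=\langle a\vee c,b\wedge d\rangle$. On $\Sigma(\mathbf A)$ put $$\langle a,b\rangle\otimes\langle c,d\rangle=\langle ((a\to d)\wedge(c\to b))\to(a\wedge c),\ N((a\to d)\wedge(c\to b))\rangle,$$ $$\langle a,b\rangle\Rightarrow\langle c,d\rangle=\langle (a\to c)\wedge(d\to b),\ N(((a\to c)\wedge(d\to b))\to(a\wedge d))\rangle.$$ The map $\delta_{\mathbf A}\langle a,b\rangle=\langle a,f\to b\rangle$ is a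 lattice isomorphism $A^{\bowtie}\to\Sigma(\mathbf A)$ with inverse $\langle a,b\rangle\mapsto\langle a,b\wedge(a\to f)\rangle$. Let $\mathbf A^{\bowtie}$ be the Sugihara monoid on $A^{\bowtie}$ with the above lattice operations, product $\delta_{\mathbf A}^{-1}(\delta_{\mathbf A}(x)\otimes\delta_{\mathbf A}(y))$, residual $\delta_{\mathbf A}^{-1}(\delta_{\mathbf A}(x)\Rightarrow\delta_{\mathbf A}(y))$, monoid identity $\langle t,f\rangle$ and involution $\langle a,b\rangle\mapsto\langle b,a\rangle$; for a homomorphism $h\colon\mathbf A\to\mathbf B$ let $h^{\bowtie}\langle a,b\rangle=\langle h(a),h(b)\rangle$. These assignments are functors $(-)_{\bowtie}\colon\mathsf{SM}\to\mathsf{bRSA}$ and $(-)^{\bowtie}\colon\mathsf{bRSA}\to\mathsf{SM}$. They extend to functors between $\mathsf{SM}_\bot$ and $\mathsf{bGA}$ by designating $\bot$ as the least element of $\mathbf A_{\bowtie}$ and $\langle\bot,t\rangle$ as the least element of $\mathbf A^{\bowtie}$. \textbf{Theorem.} The functors $(-)^{\bowtie}\colon\mathsf{bRSA}\to\mathsf{SM}$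 and $(-)_{\bowtie}\colon\mathsf{SM}\to\mathsf{bRSA}$ are mutually inverse up to natural isomorphism, and so form an equivalence of the categories $\mathsf{bRSA}$ and $\mathsf{SM}$. Likewise, their extensions form an equivalence of the categories $\mathsf{bGA}$ and $\mathsf{SM}_\bot$. -/

import Mathlib

open CategoryTheory

universe u

/-! ## Commutative residuated lattices and Sugihara monoids -/

/-- A commutative residuated lattice `(A, ⊓, ⊔, *, imp, 1)`; the monoid identity `1` is the
constant written `t` in the algebraic literature. -/
class CommResiduatedLattice (A : Type u) extends Lattice A, CommMonoid A where
  /-- the residual `a → b` -/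
  imp : A → A → A
  mul_le_iff : ∀ a b c : A, a * b ≤ c ↔ a ≤ imp b c

/-- A Sugihara monoid: a distributive, idempotent commutative residuated lattice with an
involution. -/
class SugiharaMonoid (A : Type u) extends CommResiduatedLattice A where
  inf_sup_distrib : ∀ a b c : A, a ⊓ (b ⊔ c) = (a ⊓ b) ⊔ (a ⊓ c)
  mul_idem : ∀ a : A, a * a = a
  /-- the involution `¬ a` -/
  invol : A → A
  invol_invol : ∀ a : A, invol (invol a) = a
  imp_invol : ∀ a b : A, imp a (invol b) = imp b (invol a)

open CommResiduatedLattice SugiharaMonoid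

/-! ## Semilinear Brouwerian algebras

A Brouwerian algebra (a commutative residuated lattice whose product is the meet) is exactly a
`GeneralizedHeytingAlgebra`; its residual is `⇨` and its monoid identity is `⊤`. -/

/-- Homomorphisms of Brouwerian algebras. -/
structure IsBrouwerianHom {A B : Type u} [GeneralizedHeytingAlgebra A]
    [GeneralizedHeytingAlgebra B] (h : A → B) : Prop where
  map_inf : ∀ a b, h (a ⊓ b) = h a ⊓ h b
  map_sup : ∀ a b, h (a ⊔ b) = h a ⊔ h b
  map_himp : ∀ a b, h (a ⇨ b) = h a ⇨ h b
  map_top : h ⊤ = ⊤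

/-- A Brouwerian algebra is semilinear (a relative Stone algebra) if it is a subdirect product of
totally ordered ones: it embeds in a product of totally ordered Brouwerian algebras so that every
coordinate map is onto. -/
def IsSemilinear (A : Type u) [GeneralizedHeytingAlgebra A] : Prop :=
  ∃ (ι : Type u) (C : ι → Type u) (_ : ∀ i, GeneralizedHeytingAlgebra (C i))
    (h : ∀ i, A → C i),
    (∀ i, ∀ x y : C i, x ≤ y ∨ y ≤ x) ∧
    (∀ i, IsBrouwerianHom (h i)) ∧
    (∀ i, Function.Surjective (h i)) ∧
    (∀ x y : A, (∀ i, h i x = h i y) → x = y)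

/-- To check an inequality in a semilinear algebra it suffices to check it in its totally ordered
homomorphic images. -/
theorem IsSemilinear.le_of_chain {A : Type u} [GeneralizedHeytingAlgebra A] (hA : IsSemilinear A)
    {x y : A}
    (H : ∀ (C : Type u) [GeneralizedHeytingAlgebra C] (h : A → C),
      (∀ x y : C, x ≤ y ∨ y ≤ x) → IsBrouwerianHom h → Function.Surjective h → h x ≤ h y) :
    x ≤ y := by
  obtain ⟨ι, C, inst, h, ht, hh, hs, hinj⟩ := hA
  rw [← inf_eq_left]
  refine hinj _ _ fun i => ?_
  rw [(hh i).map_inf, inf_eq_left]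
  exact H (C i) (h i) (ht i) (hh i) (hs i)

theorem IsSemilinear.eq_of_chain {A : Type u} [GeneralizedHeytingAlgebra A] (hA : IsSemilinear A)
    {x y : A}
    (H : ∀ (C : Type u) [GeneralizedHeytingAlgebra C] (h : A → C),
      (∀ x y : C, x ≤ y ∨ y ≤ x) → IsBrouwerianHom h → Function.Surjective h → h x = h y) :
    x = y :=
  le_antisymm (hA.le_of_chain fun C _ h a b c => (H C h a b c).le)
    (hA.le_of_chain fun C _ h a b c => (H C h a b c).ge)

section PrimeQuotient

variable {A : Type u} [GeneralizedHeytingAlgebra A]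

/-- A filter `P` with the property that `a ⇨ b ∈ P` or `b ⇨ a ∈ P` for all `a`, `b`. -/
structure IsLinearFilter (P : Set A) : Prop where
  top_mem : ⊤ ∈ P
  inf_mem : ∀ {a b}, a ∈ P → b ∈ P → a ⊓ b ∈ P
  mem_of_le : ∀ {a b}, a ∈ P → a ≤ b → b ∈ P
  total : ∀ a b, a ⇨ b ∈ P ∨ b ⇨ a ∈ P

namespace IsLinearFilter

variable {P : Set A}

theorem mem_of_eq_top (hP : IsLinearFilter P) {a : A} (h : a = ⊤) : a ∈ P := h ▸ hP.top_mem

theorem rel_of_le (hP : IsLinearFilter P) {a b : A} (h : a ≤ b) : a ⇨ b ∈ P := hP.mem_of_eq_top (himp_eq_top_iff.2 h)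

theorem trans (hP : IsLinearFilter P) {a b c : A} (h₁ : a ⇨ b ∈ P) (h₂ : b ⇨ c ∈ P) : a ⇨ c ∈ P :=
  hP.mem_of_le (hP.inf_mem h₁ h₂) (himp_triangle a b c)

theorem le_inf (hP : IsLinearFilter P) {a b c : A} (h₁ : a ⇨ b ∈ P) (h₂ : a ⇨ c ∈ P) : a ⇨ (b ⊓ c) ∈ P := by
  rw [himp_inf_distrib]; exact hP.inf_mem h₁ h₂

theorem sup_le (hP : IsLinearFilter P) {a b c : A} (h₁ : a ⇨ c ∈ P) (h₂ : b ⇨ c ∈ P) : (a ⊔ b) ⇨ c ∈ P := by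
  rw [sup_himp_distrib]; exact hP.inf_mem h₁ h₂

theorem inf_mono (hP : IsLinearFilter P) {a b c d : A} (h₁ : a ⇨ b ∈ P) (h₂ : c ⇨ d ∈ P) : (a ⊓ c) ⇨ (b ⊓ d) ∈ P :=
  hP.le_inf (hP.trans (hP.rel_of_le inf_le_left) h₁) (hP.trans (hP.rel_of_le inf_le_right) h₂)

theorem sup_mono (hP : IsLinearFilter P) {a b c d : A} (h₁ : a ⇨ b ∈ P) (h₂ : c ⇨ d ∈ P) : (a ⊔ c) ⇨ (b ⊔ d) ∈ P :=
  hP.sup_le (hP.trans h₁ (hP.rel_of_le le_sup_left)) (hP.trans h₂ (hP.rel_of_le le_sup_right))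

theorem himp_mono (hP : IsLinearFilter P) {a b c d : A} (h₁ : b ⇨ a ∈ P) (h₂ : c ⇨ d ∈ P) :
    (a ⇨ c) ⇨ (b ⇨ d) ∈ P := by
  refine hP.mem_of_le (hP.inf_mem h₁ h₂) ?_
  rw [le_himp_iff]
  calc (b ⇨ a) ⊓ (c ⇨ d) ⊓ (a ⇨ c) ≤ (b ⇨ a) ⊓ (a ⇨ c) ⊓ (c ⇨ d) := by
        rw [inf_right_comm]
    _ ≤ (b ⇨ c) ⊓ (c ⇨ d) := inf_le_inf_right _ (himp_triangle b a c)
    _ ≤ b ⇨ d := himp_triangle b c d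

end IsLinearFilter

/-- The congruence of a filter. -/
def filterSetoid {P : Set A} (hP : IsLinearFilter P) : Setoid A where
  r a b := a ⇨ b ∈ P ∧ b ⇨ a ∈ P
  iseqv := ⟨fun _ => ⟨hP.rel_of_le le_rfl, hP.rel_of_le le_rfl⟩, fun h => ⟨h.2, h.1⟩,
    fun h k => ⟨hP.trans h.1 k.1, hP.trans k.2 h.2⟩⟩

/-- The quotient of a Brouwerian algebra by (the congruence of) a filter. -/
def FilterQuotient {P : Set A} (hP : IsLinearFilter P) : Type u := Quotient (filterSetoid hP)

instance {P : Set A} (hP : IsLinearFilter P) : GeneralizedHeytingAlgebra (FilterQuotient hP) where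
  le := Quotient.lift₂ (fun a b => a ⇨ b ∈ P) fun _ _ _ _ h k => propext
    ⟨fun l => hP.trans h.2 (hP.trans l k.1), fun l => hP.trans h.1 (hP.trans l k.2)⟩
  le_refl := by rintro ⟨a⟩; exact hP.rel_of_le le_rfl
  le_trans := by rintro ⟨a⟩ ⟨b⟩ ⟨c⟩ h k; exact hP.trans h k
  le_antisymm := by rintro ⟨a⟩ ⟨b⟩ h k; exact Quotient.sound ⟨h, k⟩
  sup := Quotient.map₂ (· ⊔ ·) fun _ _ h _ _ k => ⟨hP.sup_mono h.1 k.1, hP.sup_mono h.2 k.2⟩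
  inf := Quotient.map₂ (· ⊓ ·) fun _ _ h _ _ k => ⟨hP.inf_mono h.1 k.1, hP.inf_mono h.2 k.2⟩
  himp := Quotient.map₂ (· ⇨ ·) fun _ _ h _ _ k => ⟨hP.himp_mono h.2 k.1, hP.himp_mono h.1 k.2⟩
  top := Quotient.mk _ ⊤
  le_top := by rintro ⟨a⟩; exact hP.rel_of_le le_top
  le_sup_left := by rintro ⟨a⟩ ⟨b⟩; exact hP.rel_of_le le_sup_left
  le_sup_right := by rintro ⟨a⟩ ⟨b⟩; exact hP.rel_of_le le_sup_right
  sup_le := by rintro ⟨a⟩ ⟨b⟩ ⟨c⟩ h k; exact hP.sup_le h k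
  inf_le_left := by rintro ⟨a⟩ ⟨b⟩; exact hP.rel_of_le inf_le_left
  inf_le_right := by rintro ⟨a⟩ ⟨b⟩; exact hP.rel_of_le inf_le_right
  le_inf := by rintro ⟨a⟩ ⟨b⟩ ⟨c⟩ h k; exact hP.le_inf h k
  le_himp_iff := by
    rintro ⟨a⟩ ⟨b⟩ ⟨c⟩
    show a ⇨ (b ⇨ c) ∈ P ↔ (a ⊓ b) ⇨ c ∈ P
    rw [himp_himp]

/-- Prelinear Brouwerian algebras are semilinear. -/
theorem isSemilinear_of_prelinear (hA : ∀ a b : A, (a ⇨ b) ⊔ (b ⇨ a) = ⊤) : IsSemilinear A := by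
  refine ⟨{P : Set A // IsLinearFilter P}, fun P => FilterQuotient P.2, fun P => inferInstance,
    fun P => Quotient.mk _, ?_, ?_, fun P => Quotient.mk_surjective, ?_⟩
  · rintro ⟨P, hP⟩ ⟨a⟩ ⟨b⟩
    exact hP.total a b
  · exact fun P => ⟨fun _ _ => rfl, fun _ _ => rfl, fun _ _ => rfl, rfl⟩
  · suffices H : ∀ x y : A, (∀ P : {P : Set A // IsLinearFilter P}, x ⇨ y ∈ P.1) → x ≤ y from
      fun x y h => le_antisymm (H x y fun P => (Quotient.exact (h P)).1)
        (H y x fun P => (Quotient.exact (h P)).2)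
    intro x y h
    by_contra hxy
    have hdis : Disjoint ((Order.PFilter.principal (⊤ : A) : Order.PFilter A) : Set A)
        ((Order.Ideal.principal (x ⇨ y) : Order.Ideal A) : Set A) := by
      rw [Set.disjoint_left]
      intro z hz hz'
      have h1 : ⊤ ≤ z := hz
      have h2 : z ≤ x ⇨ y := hz'
      exact hxy (himp_eq_top_iff.1 (top_le_iff.1 (h1.trans h2)))
    obtain ⟨J, hJ, hIJ, hFJ⟩ := DistribLattice.prime_ideal_of_disjoint_filter_ideal hdis
    have htop : (⊤ : A) ∉ J := fun ht =>
      Set.disjoint_left.1 hFJ (show (⊤ : A) ∈ Order.PFilter.principal (⊤ : A) from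
        le_refl (⊤ : A)) ht
    have hxyJ : x ⇨ y ∈ J := hIJ (Order.Ideal.mem_principal.2 le_rfl)
    refine h ⟨{z | z ∉ J}, htop, ?_, ?_, ?_⟩ hxyJ
    · intro a b ha hb hab
      exact (hJ.mem_or_mem hab).elim ha hb
    · intro a b ha hab hb
      exact ha (J.lower hab hb)
    · intro a b
      by_contra hcon
      simp only [Set.mem_ofPred_eq, not_or, not_not] at hcon
      exact htop (hA a b ▸ Order.Ideal.sup_mem hcon.1 hcon.2)

end PrimeQuotient

/-! ## Operations on pairs -/

section Pairs

variable {A : Type u} [GeneralizedHeytingAlgebra A]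

/-- The order `⟨a, b⟩ ≤ ⟨c, d⟩ ↔ a ≤ c ∧ d ≤ b` of the lattice
`⟨a, b⟩ ⊓ ⟨c, d⟩ = ⟨a ⊓ c, b ⊔ d⟩`, `⟨a, b⟩ ⊔ ⟨c, d⟩ = ⟨a ⊔ c, b ⊓ d⟩`. -/
def pairLE (p q : A × A) : Prop := p.1 ≤ q.1 ∧ q.2 ≤ p.2

def pairInf (p q : A × A) : A × A := (p.1 ⊓ q.1, p.2 ⊔ q.2)

def pairSup (p q : A × A) : A × A := (p.1 ⊔ q.1, p.2 ⊓ q.2)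

/-- The twist product multiplication, with the nucleus `N x = f ⇨ x`. -/
def pairMul (f : A) (p q : A × A) : A × A :=
  (((p.1 ⇨ q.2) ⊓ (q.1 ⇨ p.2)) ⇨ (p.1 ⊓ q.1), f ⇨ ((p.1 ⇨ q.2) ⊓ (q.1 ⇨ p.2)))

/-- The residual of the twist product multiplication, with the nucleus `N x = f ⇨ x`. -/
def pairImp (f : A) (p q : A × A) : A × A :=
  ((p.1 ⇨ q.1) ⊓ (q.2 ⇨ p.2), f ⇨ (((p.1 ⇨ q.1) ⊓ (q.2 ⇨ p.2)) ⇨ (p.1 ⊓ q.2)))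

/-- Membership in `Σ(A)`. -/
def IsSigma (f : A) (p : A × A) : Prop := p.1 ⊔ p.2 = ⊤ ∧ f ⇨ p.2 = p.2

/-- Membership in the carrier of the twist product with simple involution. -/
def IsTwist (f : A) (p : A × A) : Prop := p.1 ⊔ p.2 = ⊤ ∧ p.1 ⊓ p.2 ≤ f

theorem himp_himp_self_eq (f a : A) : f ⇨ (f ⇨ a) = f ⇨ a := by simp

theorem IsTwist.delta {f : A} {p : A × A} (hp : IsTwist f p) : IsSigma f (p.1, f ⇨ p.2) :=
  ⟨top_le_iff.1 (hp.1.ge.trans (sup_le_sup_left le_himp _)), himp_himp_self_eq _ _⟩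

theorem IsSigma.deltaInv {f : A} (hf : ∀ a : A, a ⊔ (a ⇨ f) = ⊤) {p : A × A}
    (hp : IsSigma f p) : IsTwist f (p.1, p.2 ⊓ (p.1 ⇨ f)) := by
  refine ⟨?_, ?_⟩
  · show p.1 ⊔ p.2 ⊓ (p.1 ⇨ f) = ⊤
    rw [sup_inf_left, hp.1, hf, top_inf_eq]
  · show p.1 ⊓ (p.2 ⊓ (p.1 ⇨ f)) ≤ f
    calc p.1 ⊓ (p.2 ⊓ (p.1 ⇨ f)) ≤ p.1 ⊓ (p.1 ⇨ f) := inf_le_inf_left _ inf_le_right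
      _ ≤ f := inf_himp_le

theorem IsTwist.himp_inf_himp {f : A} {p : A × A} (hp : IsTwist f p) :
    (f ⇨ p.2) ⊓ (p.1 ⇨ f) = p.2 := by
  refine le_antisymm ?_ (le_inf le_himp (le_himp_iff.2 (by rw [inf_comm]; exact hp.2)))
  calc (f ⇨ p.2) ⊓ (p.1 ⇨ f) ≤ ((f ⇨ p.2) ⊓ (p.1 ⇨ f)) ⊓ (p.1 ⊔ p.2) := by rw [hp.1, inf_top_eq]
    _ = ((f ⇨ p.2) ⊓ (p.1 ⇨ f)) ⊓ p.1 ⊔ ((f ⇨ p.2) ⊓ (p.1 ⇨ f)) ⊓ p.2 := inf_sup_left _ _ _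
    _ ≤ p.2 := by
      refine sup_le ?_ inf_le_right
      calc (f ⇨ p.2) ⊓ (p.1 ⇨ f) ⊓ p.1 = (f ⇨ p.2) ⊓ ((p.1 ⇨ f) ⊓ p.1) := inf_assoc _ _ _
        _ ≤ (f ⇨ p.2) ⊓ f := inf_le_inf_left _ himp_inf_le
        _ ≤ p.2 := himp_inf_le

theorem IsSigma.himp_deltaInv {f : A} {p : A × A} (hp : IsSigma f p) :
    f ⇨ (p.2 ⊓ (p.1 ⇨ f)) = p.2 := by
  rw [himp_inf_distrib, hp.2, himp_eq_top_iff.2 (le_himp : f ≤ p.1 ⇨ f), inf_top_eq]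

/-- A totally ordered Brouwerian algebra. -/
def IsChainAlg (A : Type u) [GeneralizedHeytingAlgebra A] : Prop := ∀ x y : A, x ≤ y ∨ y ≤ x

namespace IsChainAlg

theorem himp_of_not_le (ht : IsChainAlg A) {a b : A} (h : ¬ a ≤ b) : a ⇨ b = b := by
  refine le_antisymm ?_ le_himp
  rcases ht (a ⇨ b) a with h1 | h1
  · rw [← inf_eq_left.2 h1]; exact himp_inf_le
  · exact absurd (by have := @himp_inf_le _ _ a b; rwa [inf_eq_right.2 h1] at this) h

theorem sup_eq_top (ht : IsChainAlg A) {a b : A} (h : a ⊔ b = ⊤) : a = ⊤ ∨ b = ⊤ := by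
  rcases ht a b with h1 | h1
  · right; rwa [sup_eq_right.2 h1] at h
  · left; rwa [sup_eq_left.2 h1] at h


theorem cases_sigma (ht : IsChainAlg A) {f : A} {p : A × A} (hp : IsSigma f p) :
    (∃ b, f ⇨ b = b ∧ p = (⊤, b)) ∨ ∃ a, p = (a, ⊤) := by
  obtain ⟨a, b⟩ := p
  obtain ⟨h1, h2⟩ := hp
  rcases ht.sup_eq_top h1 with h | h
  · left; exact ⟨b, h2, by rw [← h]⟩
  · right; exact ⟨a, by rw [← h]⟩

theorem mul_pp {f b d : A} (hb : f ⇨ b = b) (hd : f ⇨ d = d) :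
    pairMul f (⊤, b) (⊤, d) = (⊤, b ⊓ d) := by
  simp [pairMul, himp_inf_distrib, hb, hd, inf_comm]

theorem mul_nn {f a c : A} : pairMul f (a, ⊤) (c, ⊤) = (a ⊓ c, ⊤) := by
  simp [pairMul]

theorem mul_pn_of_le {f b c : A} (h : c ≤ b) : pairMul f (⊤, b) (c, ⊤) = (c, ⊤) := by
  simp [pairMul, himp_eq_top_iff.2 h]

theorem mul_np_of_le {f b c : A} (h : c ≤ b) : pairMul f (c, ⊤) (⊤, b) = (c, ⊤) := by
  simp [pairMul, himp_eq_top_iff.2 h]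

theorem mul_pn_of_not_le (ht : IsChainAlg A) {f b c : A} (hb : f ⇨ b = b) (h : ¬ c ≤ b) :
    pairMul f (⊤, b) (c, ⊤) = (⊤, b) := by
  simp [pairMul, ht.himp_of_not_le h, (ht b c).resolve_right h, hb]

theorem mul_np_of_not_le (ht : IsChainAlg A) {f b c : A} (hb : f ⇨ b = b) (h : ¬ c ≤ b) :
    pairMul f (c, ⊤) (⊤, b) = (⊤, b) := by
  simp [pairMul, ht.himp_of_not_le h, (ht b c).resolve_right h, hb]

theorem mul_comm {f : A} (p q : A × A) : pairMul f p q = pairMul f q p := by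
  simp only [pairMul]
  rw [inf_comm (p.1 ⇨ q.2), inf_comm p.1]

theorem mul_ppn (ht : IsChainAlg A) {f b d a : A} (hb : f ⇨ b = b) (hd : f ⇨ d = d) :
    pairMul f (pairMul f (⊤, b) (⊤, d)) (a, ⊤) = pairMul f (⊤, b) (pairMul f (⊤, d) (a, ⊤)) := by
  have hbd : f ⇨ (b ⊓ d) = b ⊓ d := by rw [himp_inf_distrib, hb, hd]
  rw [mul_pp hb hd]
  by_cases h1 : a ≤ d
  · rw [mul_pn_of_le h1]
    by_cases h2 : a ≤ b
    · rw [mul_pn_of_le h2, mul_pn_of_le (le_inf h2 h1)]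
    · rw [ht.mul_pn_of_not_le hb h2,
        inf_eq_left.2 (((ht a b).resolve_left h2).trans h1), ht.mul_pn_of_not_le hb h2]
  · rw [ht.mul_pn_of_not_le hd h1, mul_pp hb hd,
      ht.mul_pn_of_not_le hbd fun h => h1 (h.trans inf_le_right)]

theorem mul_nnp (ht : IsChainAlg A) {f b a c : A} (hb : f ⇨ b = b) :
    pairMul f (pairMul f (a, ⊤) (c, ⊤)) (⊤, b) = pairMul f (a, ⊤) (pairMul f (c, ⊤) (⊤, b)) := by
  rw [mul_nn]
  by_cases h1 : c ≤ b
  · rw [mul_np_of_le h1, mul_nn, mul_np_of_le (inf_le_right.trans h1)]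
  · rw [ht.mul_np_of_not_le hb h1]
    by_cases h2 : a ≤ b
    · rw [mul_np_of_le h2, inf_eq_left.2 (h2.trans ((ht c b).resolve_left h1)), mul_np_of_le h2]
    · rw [ht.mul_np_of_not_le hb h2, ht.mul_np_of_not_le hb]
      rcases ht a c with h | h
      · rwa [inf_eq_left.2 h]
      · rwa [inf_eq_right.2 h]

theorem mul_assoc (ht : IsChainAlg A) {f : A} {p q r : A × A} (hp : IsSigma f p)
    (hq : IsSigma f q) (hr : IsSigma f r) :
    pairMul f (pairMul f p q) r = pairMul f p (pairMul f q r) := by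
  rcases ht.cases_sigma hp with ⟨b, hb, rfl⟩ | ⟨a, rfl⟩ <;>
    rcases ht.cases_sigma hq with ⟨d, hd, rfl⟩ | ⟨c, rfl⟩ <;>
    rcases ht.cases_sigma hr with ⟨g, hg, rfl⟩ | ⟨e, rfl⟩
  · have hbd : f ⇨ (b ⊓ d) = b ⊓ d := by rw [himp_inf_distrib, hb, hd]
    have hdg : f ⇨ (d ⊓ g) = d ⊓ g := by rw [himp_inf_distrib, hd, hg]
    rw [mul_pp hb hd, mul_pp hbd hg, mul_pp hd hg, mul_pp hb hdg, inf_assoc]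
  · exact ht.mul_ppn hb hd
  · rw [mul_comm _ (⊤, g), mul_comm (c, ⊤) (⊤, g), ← ht.mul_ppn hg hb,
      ← ht.mul_ppn hb hg, mul_comm (⊤, b) (⊤, g)]
  · rw [mul_nn, mul_comm _ (e, ⊤), mul_comm (⊤, b) (c, ⊤), ← ht.mul_nnp hb, mul_nn,
      mul_comm (⊤, b), inf_comm]
  · rw [mul_comm _ (⊤, g), mul_comm (a, ⊤) (⊤, d), ← ht.mul_ppn hg hd, mul_comm (a, ⊤),
      mul_comm (⊤, g)]
  · rw [mul_comm _ (e, ⊤), ← ht.mul_nnp hd, mul_nn, mul_comm (⊤, d) (e, ⊤), ← ht.mul_nnp hd,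
      mul_nn, inf_comm]
  · exact ht.mul_nnp hg
  · simp only [mul_nn, inf_assoc]

theorem residuation (ht : IsChainAlg A) {f : A} {p q r : A × A} (hp : IsSigma f p)
    (hq : IsSigma f q) (hr : IsSigma f r) :
    pairLE (pairMul f p q) r ↔ pairLE p (pairImp f q r) := by
  rcases ht.cases_sigma hp with ⟨b, hb, rfl⟩ | ⟨a, rfl⟩ <;>
    rcases ht.cases_sigma hq with ⟨d, hd, rfl⟩ | ⟨c, rfl⟩ <;>
    rcases ht.cases_sigma hr with ⟨g, hg, rfl⟩ | ⟨e, rfl⟩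
  · by_cases h : g ≤ d
    · simp [mul_pp hb hd, pairLE, pairImp, himp_eq_top_iff.2 h, hg, h]
    · simp [mul_pp hb hd, pairLE, pairImp, h]
  · simp only [mul_pp hb hd, pairLE, pairImp]
    simp only [himp_top, top_le_iff, top_himp, inf_top_eq, le_inf_iff]
    tauto
  · by_cases h : c ≤ b
    · have : f ⇨ (c ⊓ g) ≤ b := (himp_le_himp_left (inf_le_left.trans h)).trans hb.le
      simpa [mul_pn_of_le h, pairLE, pairImp] using this
    · have : g ≤ b ↔ f ⇨ (c ⊓ g) ≤ b := by
        refine ⟨fun h1 => (himp_le_himp_left (inf_le_right.trans h1)).trans hb.le, fun h1 => ?_⟩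
        have h2 : c ⊓ g ≤ b := le_himp.trans h1
        rcases ht c g with h3 | h3
        · exact absurd (by rwa [inf_eq_left.2 h3] at h2) h
        · rwa [inf_eq_right.2 h3] at h2
      simpa [ht.mul_pn_of_not_le hb h, pairLE, pairImp] using this
  · by_cases h : c ≤ b
    · have : c ≤ e → f ⇨ ((c ⇨ e) ⇨ c) ≤ b := fun h1 => by
        rw [himp_eq_top_iff.2 h1, top_himp]
        exact (himp_le_himp_left h).trans hb.le
      simpa [mul_pn_of_le h, pairLE, pairImp] using this
    · have : e = ⊤ ∧ b = ⊤ ↔ c ≤ e ∧ f ⇨ ((c ⇨ e) ⇨ c) ≤ b := by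
        refine ⟨fun h1 => absurd (h1.2 ▸ le_top) h, fun h1 => absurd ?_ h⟩
        exact le_himp.trans (le_himp.trans h1.2)
      simpa [ht.mul_pn_of_not_le hb h, pairLE, pairImp] using this
  · by_cases h : a ≤ d
    · have : a ⊓ g ≤ d := inf_le_left.trans h
      simpa [mul_np_of_le h, pairLE, pairImp] using this
    · have : g ≤ d ↔ a ⊓ g ≤ d := by
        refine ⟨fun h1 => inf_le_right.trans h1, fun h2 => ?_⟩
        rcases ht a g with h3 | h3
        · exact absurd (by rwa [inf_eq_left.2 h3] at h2) h
        · rwa [inf_eq_right.2 h3] at h2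
      simpa [ht.mul_np_of_not_le hd h, pairLE, pairImp] using this
  · by_cases h : a ≤ d
    · have : a ≤ e → a ≤ d := fun _ => h
      simpa [mul_np_of_le h, pairLE, pairImp] using this
    · have : e = ⊤ ∧ d = ⊤ ↔ a ≤ e ∧ a ≤ d :=
        ⟨fun h1 => absurd (h1.2 ▸ le_top) h, fun h1 => absurd h1.2 h⟩
      simpa [ht.mul_np_of_not_le hd h, pairLE, pairImp] using this
  · simp [mul_nn, pairLE, pairImp]
  · simp [mul_nn, pairLE, pairImp]

theorem mul_self (ht : IsChainAlg A) {f : A} {p : A × A} (hp : IsSigma f p) :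
    pairMul f p p = p := by
  rcases ht.cases_sigma hp with ⟨b, hb, rfl⟩ | ⟨a, rfl⟩
  · rw [mul_pp hb hb, inf_idem]
  · rw [mul_nn, inf_idem]

theorem sigma_mul (ht : IsChainAlg A) {f : A} {p q : A × A} (hp : IsSigma f p)
    (hq : IsSigma f q) : IsSigma f (pairMul f p q) := by
  have hn : ∀ a : A, IsSigma f (a, ⊤) := fun a => ⟨by simp, by simp⟩
  rcases ht.cases_sigma hp with ⟨b, hb, rfl⟩ | ⟨a, rfl⟩ <;>
    rcases ht.cases_sigma hq with ⟨d, hd, rfl⟩ | ⟨c, rfl⟩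
  · rw [mul_pp hb hd]
    exact ⟨by simp, by show f ⇨ (b ⊓ d) = b ⊓ d; rw [himp_inf_distrib, hb, hd]⟩
  · by_cases h : c ≤ b
    · rw [mul_pn_of_le h]; exact hn c
    · rwa [ht.mul_pn_of_not_le hb h]
  · by_cases h : a ≤ d
    · rw [mul_np_of_le h]; exact hn a
    · rwa [ht.mul_np_of_not_le hd h]
  · rw [mul_nn]; exact hn _

theorem sigma_imp (ht : IsChainAlg A) {f : A} {p q : A × A} (hp : IsSigma f p)
    (hq : IsSigma f q) : IsSigma f (pairImp f p q) := by
  refine ⟨?_, by simp [pairImp]⟩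
  rcases ht.cases_sigma hp with ⟨b, hb, rfl⟩ | ⟨a, rfl⟩ <;>
    rcases ht.cases_sigma hq with ⟨d, hd, rfl⟩ | ⟨c, rfl⟩
  · by_cases h : d ≤ b
    · simp [pairImp, himp_eq_top_iff.2 h]
    · simp [pairImp, ht.himp_of_not_le h, himp_eq_top_iff.2 ((ht d b).resolve_left h)]
  · simp [pairImp]
  · simp [pairImp]
  · by_cases h : a ≤ c
    · simp [pairImp, himp_eq_top_iff.2 h]
    · simp [pairImp, ht.himp_of_not_le h, himp_eq_top_iff.2 ((ht a c).resolve_left h)]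

theorem sigma_inf (ht : IsChainAlg A) {f : A} {p q : A × A} (hp : IsSigma f p)
    (hq : IsSigma f q) : IsSigma f (pairInf p q) := by
  obtain ⟨a, b⟩ := p
  obtain ⟨c, d⟩ := q
  obtain ⟨h1, h2⟩ := hp
  obtain ⟨h3, h4⟩ := hq
  refine ⟨?_, ?_⟩
  · show a ⊓ c ⊔ (b ⊔ d) = ⊤
    rw [sup_inf_right, ← sup_assoc, h1, sup_comm b, ← sup_assoc, h3]
    simp
  · show f ⇨ (b ⊔ d) = b ⊔ d
    rcases ht b d with h | h
    · rwa [sup_eq_right.2 h]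
    · rwa [sup_eq_left.2 h]

end IsChainAlg

/-! Transfer from totally ordered images -/

variable {f : A} {p q r : A × A}

theorem IsBrouwerianHom.map_mul {B : Type u} [GeneralizedHeytingAlgebra B] {h : A → B}
    (hh : IsBrouwerianHom h) (f : A) (p q : A × A) :
    Prod.map h h (pairMul f p q) = pairMul (h f) (Prod.map h h p) (Prod.map h h q) := by
  simp [pairMul, hh.map_himp, hh.map_inf]

theorem IsBrouwerianHom.map_imp {B : Type u} [GeneralizedHeytingAlgebra B] {h : A → B}
    (hh : IsBrouwerianHom h) (f : A) (p q : A × A) :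
    Prod.map h h (pairImp f p q) = pairImp (h f) (Prod.map h h p) (Prod.map h h q) := by
  simp [pairImp, hh.map_himp, hh.map_inf]

theorem IsBrouwerianHom.map_pairInf {B : Type u} [GeneralizedHeytingAlgebra B] {h : A → B}
    (hh : IsBrouwerianHom h) (p q : A × A) :
    Prod.map h h (pairInf p q) = pairInf (Prod.map h h p) (Prod.map h h q) := by
  simp [pairInf, hh.map_sup, hh.map_inf]

theorem IsBrouwerianHom.mono {B : Type u} [GeneralizedHeytingAlgebra B] {h : A → B}
    (hh : IsBrouwerianHom h) {a b : A} (hab : a ≤ b) : h a ≤ h b := by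
  rw [← inf_eq_left, ← hh.map_inf, inf_eq_left.2 hab]

theorem IsBrouwerianHom.map_le {B : Type u} [GeneralizedHeytingAlgebra B] {h : A → B}
    (hh : IsBrouwerianHom h) (hp : pairLE p q) : pairLE (Prod.map h h p) (Prod.map h h q) :=
  ⟨hh.mono hp.1, hh.mono hp.2⟩

theorem IsBrouwerianHom.map_sigma {B : Type u} [GeneralizedHeytingAlgebra B] {h : A → B}
    (hh : IsBrouwerianHom h) (hp : IsSigma f p) : IsSigma (h f) (Prod.map h h p) :=
  ⟨by simp only [Prod.map]; rw [← hh.map_sup, hp.1, hh.map_top],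
    by simp only [Prod.map]; rw [← hh.map_himp, hp.2]⟩

namespace IsSemilinear

theorem pair_eq (hA : IsSemilinear A) {p q : A × A}
    (H : ∀ (C : Type u) [GeneralizedHeytingAlgebra C] (h : A → C),
      IsChainAlg C → IsBrouwerianHom h → Prod.map h h p = Prod.map h h q) : p = q :=
  Prod.ext
    (hA.eq_of_chain fun C _ h ht hh _ => congrArg Prod.fst (H C h ht hh))
    (hA.eq_of_chain fun C _ h ht hh _ => congrArg Prod.snd (H C h ht hh))

theorem pair_le (hA : IsSemilinear A) {p q : A × A}
    (H : ∀ (C : Type u) [GeneralizedHeytingAlgebra C] (h : A → C),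
      IsChainAlg C → IsBrouwerianHom h → pairLE (Prod.map h h p) (Prod.map h h q)) :
    pairLE p q :=
  ⟨hA.le_of_chain fun C _ h ht hh _ => (H C h ht hh).1,
    hA.le_of_chain fun C _ h ht hh _ => (H C h ht hh).2⟩

theorem sigma (hA : IsSemilinear A) {f : A} {p : A × A}
    (H : ∀ (C : Type u) [GeneralizedHeytingAlgebra C] (h : A → C),
      IsChainAlg C → IsBrouwerianHom h → IsSigma (h f) (Prod.map h h p)) : IsSigma f p :=
  ⟨hA.eq_of_chain fun C _ h ht hh _ => by
      rw [hh.map_sup, hh.map_top]; exact (H C h ht hh).1,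
    hA.eq_of_chain fun C _ h ht hh _ => by
      rw [hh.map_himp]; exact (H C h ht hh).2⟩

theorem sigma_mul (hA : IsSemilinear A) (hp : IsSigma f p) (hq : IsSigma f q) :
    IsSigma f (pairMul f p q) :=
  hA.sigma fun _ _ _ ht hh => by
    rw [hh.map_mul]; exact ht.sigma_mul (hh.map_sigma hp) (hh.map_sigma hq)

theorem sigma_imp (hA : IsSemilinear A) (hp : IsSigma f p) (hq : IsSigma f q) :
    IsSigma f (pairImp f p q) :=
  hA.sigma fun _ _ _ ht hh => by
    rw [hh.map_imp]; exact ht.sigma_imp (hh.map_sigma hp) (hh.map_sigma hq)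

theorem sigma_inf (hA : IsSemilinear A) (hp : IsSigma f p) (hq : IsSigma f q) :
    IsSigma f (pairInf p q) :=
  hA.sigma fun _ _ _ ht hh => by
    rw [hh.map_pairInf]; exact ht.sigma_inf (hh.map_sigma hp) (hh.map_sigma hq)

theorem mul_assoc (hA : IsSemilinear A) (hp : IsSigma f p) (hq : IsSigma f q)
    (hr : IsSigma f r) : pairMul f (pairMul f p q) r = pairMul f p (pairMul f q r) :=
  hA.pair_eq fun _ _ _ ht hh => by
    simp only [hh.map_mul]
    exact ht.mul_assoc (hh.map_sigma hp) (hh.map_sigma hq) (hh.map_sigma hr)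

theorem mul_self (hA : IsSemilinear A) (hp : IsSigma f p) : pairMul f p p = p :=
  hA.pair_eq fun _ _ _ ht hh => by
    simp only [hh.map_mul]
    exact ht.mul_self (hh.map_sigma hp)

theorem residuation (hA : IsSemilinear A) (hp : IsSigma f p) (hq : IsSigma f q)
    (hr : IsSigma f r) : pairLE (pairMul f p q) r ↔ pairLE p (pairImp f q r) := by
  refine ⟨fun h => hA.pair_le fun _ _ _ ht hh => ?_, fun h => hA.pair_le fun _ _ _ ht hh => ?_⟩
  · rw [hh.map_imp, ← ht.residuation (hh.map_sigma hp) (hh.map_sigma hq) (hh.map_sigma hr),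
      ← hh.map_mul]
    exact hh.map_le h
  · rw [hh.map_mul, ht.residuation (hh.map_sigma hp) (hh.map_sigma hq) (hh.map_sigma hr),
      ← hh.map_imp]
    exact hh.map_le h

end IsSemilinear

theorem IsSigma.sup (hp : IsSigma f p) (hq : IsSigma f q) : IsSigma f (pairSup p q) := by
  obtain ⟨a, b⟩ := p
  obtain ⟨c, d⟩ := q
  obtain ⟨h1, h2⟩ := hp
  obtain ⟨h3, h4⟩ := hq
  dsimp only at *
  refine ⟨?_, ?_⟩
  · show a ⊔ c ⊔ b ⊓ d = ⊤
    rw [sup_inf_left, sup_right_comm, h1, sup_assoc, h3]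
    simp
  · show f ⇨ (b ⊓ d) = b ⊓ d
    rw [himp_inf_distrib, h2, h4]

theorem IsTwist.sup (hp : IsTwist f p) (hq : IsTwist f q) : IsTwist f (pairSup p q) := by
  obtain ⟨a, b⟩ := p
  obtain ⟨c, d⟩ := q
  obtain ⟨h1, h2⟩ := hp
  obtain ⟨h3, h4⟩ := hq
  dsimp only at *
  refine ⟨?_, ?_⟩
  · show a ⊔ c ⊔ b ⊓ d = ⊤
    rw [sup_inf_left, sup_right_comm, h1, sup_assoc, h3]
    simp
  · show (a ⊔ c) ⊓ (b ⊓ d) ≤ f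
    rw [inf_sup_right]
    exact sup_le ((inf_le_inf_left _ inf_le_left).trans h2)
      ((inf_le_inf_left _ inf_le_right).trans h4)

theorem IsTwist.swap (hp : IsTwist f p) : IsTwist f p.swap :=
  ⟨by rw [Prod.fst_swap, Prod.snd_swap, sup_comm]; exact hp.1,
    by rw [Prod.fst_swap, Prod.snd_swap, inf_comm]; exact hp.2⟩

theorem IsTwist.inf (hp : IsTwist f p) (hq : IsTwist f q) : IsTwist f (pairInf p q) :=
  (hp.swap.sup hq.swap).swap

/-- The involution of the twist product is carried by `⟨a, b⟩ ↦ ⟨a, f ⇨ b⟩` to residuation into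
`⟨f, ⊤⟩`. -/
theorem IsTwist.delta_swap (hp : IsTwist f p) :
    pairImp f (p.1, f ⇨ p.2) (f, ⊤) = (p.2, f ⇨ p.1) := by
  have h1 : (p.1 ⇨ f) ⊓ (f ⇨ p.2) = p.2 := by rw [inf_comm]; exact hp.himp_inf_himp
  have h2 : p.2 ⇨ p.1 = p.1 := by
    refine le_antisymm ?_ le_himp
    calc p.2 ⇨ p.1 = (p.2 ⇨ p.1) ⊓ (p.1 ⊔ p.2) := by rw [hp.1, inf_top_eq]
      _ = (p.2 ⇨ p.1) ⊓ p.1 ⊔ (p.2 ⇨ p.1) ⊓ p.2 := inf_sup_left _ _ _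
      _ ≤ p.1 := sup_le inf_le_right himp_inf_le
  simp only [pairImp, top_himp, inf_top_eq, h1, h2]

end Pairs

/-! ## The categories -/

/-- The category `bRSA`: relative Stone algebras with a Boolean constant `f`. -/
structure BRSA : Type (u + 1) where
  carrier : Type u
  [alg : GeneralizedHeytingAlgebra carrier]
  f : carrier
  semilinear : IsSemilinear carrier
  sup_himp : ∀ a : carrier, a ⊔ (a ⇨ f) = ⊤

attribute [instance] BRSA.alg

/-- Homomorphisms in the signature `(⊓, ⊔, ⇨, ⊤, f)`. -/
@[ext]
structure BRSA.Hom (A B : BRSA.{u}) : Type u where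
  toFun : A.carrier → B.carrier
  map_inf : ∀ a b, toFun (a ⊓ b) = toFun a ⊓ toFun b
  map_sup : ∀ a b, toFun (a ⊔ b) = toFun a ⊔ toFun b
  map_himp : ∀ a b, toFun (a ⇨ b) = toFun a ⇨ toFun b
  map_top : toFun ⊤ = ⊤
  map_f : toFun A.f = B.f

/-- Identity homomorphism. -/
def BRSA.Hom.id (A : BRSA.{u}) : BRSA.Hom A A :=
  ⟨fun a => a, fun _ _ => rfl, fun _ _ => rfl, fun _ _ => rfl, rfl, rfl⟩

/-- Composition, first `h` then `k`. -/
def BRSA.Hom.comp {A B C : BRSA.{u}} (h : BRSA.Hom A B) (k : BRSA.Hom B C) : BRSA.Hom A C where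
  toFun a := k.toFun (h.toFun a)
  map_inf a b := by rw [h.map_inf, k.map_inf]
  map_sup a b := by rw [h.map_sup, k.map_sup]
  map_himp a b := by rw [h.map_himp, k.map_himp]
  map_top := by rw [h.map_top, k.map_top]
  map_f := by rw [h.map_f, k.map_f]

instance : Category.{u} BRSA.{u} where
  Hom := BRSA.Hom
  id := BRSA.Hom.id
  comp := BRSA.Hom.comp

/-- The category `bGA`: Gödel algebras with a Boolean constant, i.e. objects of `bRSA` expanded by
a constant `bot` denoting a least element. -/
structure BGA : Type (u + 1) extends BRSA.{u} where
  bot : carrier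
  bot_le : ∀ a : carrier, bot ≤ a

/-- Homomorphisms in the signature `(⊓, ⊔, ⇨, ⊤, f, bot)`. -/
@[ext]
structure BGA.Hom (A B : BGA.{u}) : Type u extends BRSA.Hom A.toBRSA B.toBRSA where
  map_bot : toFun A.bot = B.bot

instance : Category.{u} BGA.{u} where
  Hom := BGA.Hom
  id A := ⟨BRSA.Hom.id A.toBRSA, rfl⟩
  comp h k := ⟨h.toHom.comp k.toHom, by
    show k.toFun (h.toFun _) = _
    rw [h.map_bot, k.map_bot]⟩

/-- The category `SM` of Sugihara monoids. -/
structure SM : Type (u + 1) where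
  carrier : Type u
  [alg : SugiharaMonoid carrier]

attribute [instance] SM.alg

/-- Homomorphisms in the signature `(⊓, ⊔, *, imp, 1, invol)`. -/
@[ext]
structure SM.Hom (A B : SM.{u}) : Type u where
  toFun : A.carrier → B.carrier
  map_inf : ∀ a b, toFun (a ⊓ b) = toFun a ⊓ toFun b
  map_sup : ∀ a b, toFun (a ⊔ b) = toFun a ⊔ toFun b
  map_mul : ∀ a b, toFun (a * b) = toFun a * toFun b
  map_imp : ∀ a b, toFun (imp a b) = imp (toFun a) (toFun b)
  map_one : toFun 1 = 1
  map_invol : ∀ a, toFun (invol a) = invol (toFun a)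

/-- Identity homomorphism. -/
def SM.Hom.id (A : SM.{u}) : SM.Hom A A :=
  ⟨fun a => a, fun _ _ => rfl, fun _ _ => rfl, fun _ _ => rfl, fun _ _ => rfl, rfl, fun _ => rfl⟩

/-- Composition, first `h` then `k`. -/
def SM.Hom.comp {A B C : SM.{u}} (h : SM.Hom A B) (k : SM.Hom B C) : SM.Hom A C where
  toFun a := k.toFun (h.toFun a)
  map_inf a b := by rw [h.map_inf, k.map_inf]
  map_sup a b := by rw [h.map_sup, k.map_sup]
  map_mul a b := by rw [h.map_mul, k.map_mul]
  map_imp a b := by rw [h.map_imp, k.map_imp]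
  map_one := by rw [h.map_one, k.map_one]
  map_invol a := by rw [h.map_invol, k.map_invol]

instance : Category.{u} SM.{u} where
  Hom := SM.Hom
  id := SM.Hom.id
  comp := SM.Hom.comp

/-- The category of bounded Sugihara monoids: Sugihara monoids expanded by a constant `bot`
denoting a least element. -/
structure SMBot : Type (u + 1) extends SM.{u} where
  bot : carrier
  bot_le : ∀ a : carrier, bot ≤ a

/-- Homomorphisms in the signature `(⊓, ⊔, *, imp, 1, invol, bot)`. -/
@[ext]
structure SMBot.Hom (A B : SMBot.{u}) : Type u extends SM.Hom A.toSM B.toSM where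
  map_bot : toFun A.bot = B.bot

instance : Category.{u} SMBot.{u} where
  Hom := SMBot.Hom
  id A := ⟨SM.Hom.id A.toSM, rfl⟩
  comp h k := ⟨h.toHom.comp k.toHom, by
    show k.toFun (h.toFun _) = _
    rw [h.map_bot, k.map_bot]⟩

/-! ## The enriched negative cone -/

section NegativeCone

variable {A : Type u}

theorem crl_mul_mono [CommResiduatedLattice A] {a b c d : A} (h : a ≤ b) (k : c ≤ d) :
    a * c ≤ b * d := by
  have h1 : ∀ {x y : A} (z : A), x ≤ y → x * z ≤ y * z := fun z hxy =>
    (mul_le_iff _ _ _).2 (hxy.trans ((mul_le_iff _ _ _).1 le_rfl))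
  calc a * c ≤ b * c := h1 c h
    _ = c * b := _root_.mul_comm _ _
    _ ≤ d * b := h1 b k
    _ = b * d := _root_.mul_comm _ _

theorem crl_mul_imp_le [CommResiduatedLattice A] (a b : A) : a * imp a b ≤ b := by
  rw [_root_.mul_comm]; exact (mul_le_iff _ _ _).2 le_rfl

theorem crl_one_imp [CommResiduatedLattice A] (a : A) : imp 1 a = a := by
  refine le_antisymm ?_ ((mul_le_iff _ _ _).1 (by rw [mul_one]))
  have := crl_mul_imp_le 1 a
  rwa [one_mul] at this

theorem crl_imp_imp [CommResiduatedLattice A] (a b c : A) : imp a (imp b c) = imp (a * b) c := by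
  refine eq_of_forall_le_iff fun x => ?_
  rw [← mul_le_iff, ← mul_le_iff, ← mul_le_iff, _root_.mul_assoc]

variable [SugiharaMonoid A]

theorem imp_invol_one (a : A) : imp a (invol 1) = invol a := by
  rw [imp_invol, crl_one_imp]

theorem invol_anti {a b : A} (h : a ≤ b) : invol b ≤ invol a := by
  rw [← imp_invol_one a, ← imp_invol_one b, ← mul_le_iff]
  exact (crl_mul_mono le_rfl h).trans (by rw [_root_.mul_comm]; exact crl_mul_imp_le _ _)

theorem mul_invol_le (a : A) : a * invol a ≤ invol 1 := by
  rw [← imp_invol_one a]; exact crl_mul_imp_le _ _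

theorem invol_one_le : invol (1 : A) ≤ 1 := by
  have h : invol (1 : A) ≤ imp (invol 1) (invol 1) := (mul_le_iff _ _ _).1 (mul_idem _).le
  rwa [imp_invol_one, invol_invol] at h

theorem one_le_of_invol_le {a : A} (h : invol a ≤ invol 1) : 1 ≤ a := by
  have := invol_anti h
  rwa [invol_invol, invol_invol] at this

theorem one_le_sup_invol (a : A) : 1 ≤ a ⊔ invol a := by
  refine one_le_of_invol_le ?_
  rw [← mul_idem (invol (a ⊔ invol a))]
  refine (crl_mul_mono (invol_anti le_sup_right) (invol_anti le_sup_left)).trans ?_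
  rw [invol_invol]
  exact mul_invol_le a

theorem invol_imp (a b : A) : invol (imp a b) = a * invol b := by
  rw [← invol_invol (a * invol b), ← imp_invol_one (a * invol b), ← crl_imp_imp,
    imp_invol_one, invol_invol]

theorem one_le_imp_sup_imp (a b : A) : 1 ≤ imp a b ⊔ imp b a := by
  refine one_le_of_invol_le ?_
  rw [← mul_idem (invol (imp a b ⊔ imp b a))]
  refine (crl_mul_mono (invol_anti le_sup_left) (invol_anti le_sup_right)).trans ?_
  rw [invol_imp, invol_imp]
  calc a * invol b * (b * invol a) = a * invol a * (b * invol b) := by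
        rw [mul_mul_mul_comm, _root_.mul_comm (invol b), mul_mul_mul_comm]
    _ ≤ invol 1 * invol 1 := crl_mul_mono (mul_invol_le a) (mul_invol_le b)
    _ = invol 1 := mul_idem _

theorem mul_eq_inf {a b : A} (ha : a ≤ 1) (hb : b ≤ 1) : a * b = a ⊓ b := by
  refine le_antisymm (le_inf ?_ ?_) ?_
  · simpa using crl_mul_mono (le_refl a) hb
  · simpa using crl_mul_mono ha (le_refl b)
  · rw [← mul_idem (a ⊓ b)]
    exact crl_mul_mono inf_le_left inf_le_right

/-- The carrier `{a | a ≤ 1}` of the negative cone. -/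
def NegCone (A : Type u) [SugiharaMonoid A] : Type u := {a : A // a ≤ 1}

/-- The negative cone with the operations `⊓`, `⊔`, `a ⇨ b = (a → b) ⊓ 1`, and top `1`. (On the
negative cone `*` and `⊓` coincide.) -/
instance : GeneralizedHeytingAlgebra (NegCone A) where
  le a b := a.1 ≤ b.1
  le_refl a := le_refl a.1
  le_trans _ _ _ := le_trans
  le_antisymm _ _ h k := Subtype.ext (le_antisymm h k)
  sup a b := ⟨a.1 ⊔ b.1, sup_le a.2 b.2⟩
  inf a b := ⟨a.1 ⊓ b.1, inf_le_left.trans a.2⟩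
  himp a b := ⟨imp a.1 b.1 ⊓ 1, inf_le_right⟩
  top := ⟨1, le_rfl⟩
  le_top a := a.2
  le_sup_left _ _ := le_sup_left
  le_sup_right _ _ := le_sup_right
  sup_le _ _ _ := sup_le
  inf_le_left _ _ := inf_le_left
  inf_le_right _ _ := inf_le_right
  le_inf _ _ _ := le_inf
  le_himp_iff a b c := by
    show a.1 ≤ imp b.1 c.1 ⊓ 1 ↔ a.1 ⊓ b.1 ≤ c.1
    rw [← mul_eq_inf a.2 b.2, mul_le_iff, le_inf_iff]
    exact and_iff_left a.2

theorem negCone_semilinear : IsSemilinear (NegCone A) :=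
  isSemilinear_of_prelinear fun a b => Subtype.ext (by
    show (imp a.1 b.1 ⊓ 1) ⊔ (imp b.1 a.1 ⊓ 1) = 1
    rw [inf_comm _ (1 : A), inf_comm _ (1 : A), ← inf_sup_distrib, inf_eq_left]
    exact one_le_imp_sup_imp _ _)

theorem negCone_sup_himp (a : NegCone A) : a ⊔ (a ⇨ ⟨invol 1, invol_one_le⟩) = ⊤ :=
  Subtype.ext (by
    show a.1 ⊔ (imp a.1 (invol 1) ⊓ 1) = 1
    rw [imp_invol_one]
    refine le_antisymm (sup_le a.2 inf_le_right) ?_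
    calc (1 : A) = 1 ⊓ (a.1 ⊔ invol a.1) := (inf_eq_left.2 (one_le_sup_invol _)).symm
      _ = (1 ⊓ a.1) ⊔ (1 ⊓ invol a.1) := inf_sup_distrib _ _ _
      _ ≤ a.1 ⊔ (invol a.1 ⊓ 1) := sup_le_sup inf_le_right (by rw [inf_comm]))

end NegativeCone

/-- The enriched negative cone of a Sugihara monoid, with Boolean constant `f = ¬ t`. -/
def negConeObj (A : SM.{u}) : BRSA.{u} where
  carrier := NegCone A.carrier
  f := ⟨invol 1, invol_one_le⟩
  semilinear := negCone_semilinear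
  sup_himp := negCone_sup_himp

/-- The restriction of a homomorphism to the negative cones. -/
def negConeMap {A B : SM.{u}} (h : SM.Hom A B) : BRSA.Hom (negConeObj A) (negConeObj B) where
  toFun a := ⟨h.toFun a.1, by
    rw [← inf_eq_left, ← h.map_one, ← h.map_inf, inf_eq_left.2 a.2]⟩
  map_inf a b := Subtype.ext (h.map_inf a.1 b.1)
  map_sup a b := Subtype.ext (h.map_sup a.1 b.1)
  map_himp a b := Subtype.ext (by
    show h.toFun (imp a.1 b.1 ⊓ 1) = imp (h.toFun a.1) (h.toFun b.1) ⊓ 1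
    rw [h.map_inf, h.map_imp, h.map_one])
  map_top := Subtype.ext h.map_one
  map_f := Subtype.ext (by
    show h.toFun (invol 1) = invol 1
    rw [h.map_invol, h.map_one])

/-- The functor `(-)_⋈ : SM ⥤ bRSA`. -/
def negCone : SM.{u} ⥤ BRSA.{u} where
  obj := negConeObj
  map := negConeMap

/-- The functor `(-)_⋈` between the bounded categories. -/
def negConeBot : SMBot.{u} ⥤ BGA.{u} where
  obj A :=
    { negConeObj A.toSM with
      bot := (⟨A.bot, A.bot_le 1⟩ : NegCone A.carrier)
      bot_le := fun a => A.bot_le a.1 }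
  map h :=
    { negConeMap h.toHom with
      map_bot := Subtype.ext h.map_bot }

/-! ## The twist product with simple involution -/

/-- The carrier `Σ(A) = {⟨a, b⟩ | a ⊔ b = ⊤, f ⇨ b = b}`. -/
def SigmaTwist (A : BRSA.{u}) : Type u := {p : A.carrier × A.carrier // IsSigma A.f p}

instance (A : BRSA.{u}) : CommResiduatedLattice (SigmaTwist A) where
  le p q := pairLE p.1 q.1
  le_refl p := ⟨le_rfl, le_rfl⟩
  le_trans _ _ _ h k := ⟨h.1.trans k.1, k.2.trans h.2⟩
  le_antisymm _ _ h k := Subtype.ext (Prod.ext (h.1.antisymm k.1) (k.2.antisymm h.2))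
  sup p q := ⟨pairSup p.1 q.1, p.2.sup q.2⟩
  inf p q := ⟨pairInf p.1 q.1, A.semilinear.sigma_inf p.2 q.2⟩
  le_sup_left _ _ := ⟨le_sup_left, inf_le_left⟩
  le_sup_right _ _ := ⟨le_sup_right, inf_le_right⟩
  sup_le _ _ _ h k := ⟨sup_le h.1 k.1, le_inf h.2 k.2⟩
  inf_le_left _ _ := ⟨inf_le_left, le_sup_left⟩
  inf_le_right _ _ := ⟨inf_le_right, le_sup_right⟩
  le_inf _ _ _ h k := ⟨le_inf h.1 k.1, sup_le h.2 k.2⟩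
  mul p q := ⟨pairMul A.f p.1 q.1, A.semilinear.sigma_mul p.2 q.2⟩
  one := ⟨(⊤, ⊤), by simp, by simp⟩
  mul_assoc p q r := Subtype.ext (A.semilinear.mul_assoc p.2 q.2 r.2)
  mul_comm p q := Subtype.ext (IsChainAlg.mul_comm p.1 q.1)
  one_mul p := Subtype.ext (by
    show pairMul A.f (⊤, ⊤) p.1 = p.1
    have h1 : p.1.2 ⇨ p.1.1 = p.1.1 := by
      refine le_antisymm ?_ le_himp
      calc p.1.2 ⇨ p.1.1 = (p.1.2 ⇨ p.1.1) ⊓ (p.1.1 ⊔ p.1.2) := by rw [p.2.1, inf_top_eq]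
        _ = (p.1.2 ⇨ p.1.1) ⊓ p.1.1 ⊔ (p.1.2 ⇨ p.1.1) ⊓ p.1.2 := inf_sup_left _ _ _
        _ ≤ p.1.1 := sup_le inf_le_right himp_inf_le
    simp only [pairMul, top_himp, himp_top, inf_top_eq, top_inf_eq, h1, p.2.2])
  mul_one p := Subtype.ext (by
    show pairMul A.f p.1 (⊤, ⊤) = p.1
    have h1 : p.1.2 ⇨ p.1.1 = p.1.1 := by
      refine le_antisymm ?_ le_himp
      calc p.1.2 ⇨ p.1.1 = (p.1.2 ⇨ p.1.1) ⊓ (p.1.1 ⊔ p.1.2) := by rw [p.2.1, inf_top_eq]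
        _ = (p.1.2 ⇨ p.1.1) ⊓ p.1.1 ⊔ (p.1.2 ⇨ p.1.1) ⊓ p.1.2 := inf_sup_left _ _ _
        _ ≤ p.1.1 := sup_le inf_le_right himp_inf_le
    simp only [pairMul, top_himp, himp_top, inf_top_eq, top_inf_eq, h1, p.2.2])
  imp p q := ⟨pairImp A.f p.1 q.1, A.semilinear.sigma_imp p.2 q.2⟩
  mul_le_iff p q r := A.semilinear.residuation p.2 q.2 r.2

/-- The carrier `{⟨a, b⟩ | a ⊔ b = ⊤, a ⊓ b ≤ f}` of `A^⋈`. -/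
def Twist (A : BRSA.{u}) : Type u := {p : A.carrier × A.carrier // IsTwist A.f p}

instance (A : BRSA.{u}) : Lattice (Twist A) where
  le p q := pairLE p.1 q.1
  le_refl p := ⟨le_rfl, le_rfl⟩
  le_trans _ _ _ h k := ⟨h.1.trans k.1, k.2.trans h.2⟩
  le_antisymm _ _ h k := Subtype.ext (Prod.ext (h.1.antisymm k.1) (k.2.antisymm h.2))
  sup p q := ⟨pairSup p.1 q.1, p.2.sup q.2⟩
  inf p q := ⟨pairInf p.1 q.1, p.2.inf q.2⟩
  le_sup_left _ _ := ⟨le_sup_left, inf_le_left⟩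
  le_sup_right _ _ := ⟨le_sup_right, inf_le_right⟩
  sup_le _ _ _ h k := ⟨sup_le h.1 k.1, le_inf h.2 k.2⟩
  inf_le_left _ _ := ⟨inf_le_left, le_sup_left⟩
  inf_le_right _ _ := ⟨inf_le_right, le_sup_right⟩
  le_inf _ _ _ h k := ⟨le_inf h.1 k.1, sup_le h.2 k.2⟩

/-- The lattice isomorphism `δ ⟨a, b⟩ = ⟨a, f ⇨ b⟩`, with inverse
`⟨a, b⟩ ↦ ⟨a, b ⊓ (a ⇨ f)⟩`. -/
def delta (A : BRSA.{u}) : Twist A ≃o SigmaTwist A where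
  toFun p := ⟨(p.1.1, A.f ⇨ p.1.2), p.2.delta⟩
  invFun p := ⟨(p.1.1, p.1.2 ⊓ (p.1.1 ⇨ A.f)), p.2.deltaInv A.sup_himp⟩
  left_inv p := Subtype.ext (Prod.ext rfl p.2.himp_inf_himp)
  right_inv p := Subtype.ext (Prod.ext rfl p.2.himp_deltaInv)
  map_rel_iff' := by
    intro p q
    constructor
    · rintro ⟨h1, h2⟩
      refine ⟨h1, ?_⟩
      rw [← p.2.himp_inf_himp, ← q.2.himp_inf_himp]
      exact inf_le_inf h2 (himp_le_himp_right h1)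
    · rintro ⟨h1, h2⟩
      exact ⟨h1, himp_le_himp_left h2⟩

/-- The constant `⟨f, ⊤⟩` of `Σ(A)`. -/
def sigmaF (A : BRSA.{u}) : SigmaTwist A := ⟨(A.f, ⊤), by simp, by simp⟩

theorem delta_invol (A : BRSA.{u}) (p : Twist A) :
    imp (delta A p) (sigmaF A) = delta A ⟨p.1.swap, p.2.swap⟩ :=
  Subtype.ext p.2.delta_swap

/-- The Sugihara monoid `A^⋈`: the product and the residual are transported along `δ`, the monoid
identity is `⟨⊤, f⟩`, and the involution is `⟨a, b⟩ ↦ ⟨b, a⟩`. -/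
instance (A : BRSA.{u}) : SugiharaMonoid (Twist A) where
  mul p q := (delta A).symm (delta A p * delta A q)
  one := ⟨(⊤, A.f), by simp, by simp⟩
  mul_assoc p q r := by
    show (delta A).symm (delta A ((delta A).symm (delta A p * delta A q)) * delta A r) =
      (delta A).symm (delta A p * delta A ((delta A).symm (delta A q * delta A r)))
    rw [OrderIso.apply_symm_apply, OrderIso.apply_symm_apply, _root_.mul_assoc]
  mul_comm p q := congrArg (delta A).symm (_root_.mul_comm _ _)
  one_mul p := by
    show (delta A).symm (delta A ⟨(⊤, A.f), _⟩ * delta A p) = p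
    have h : delta A ⟨(⊤, A.f), by simp, by simp⟩ = 1 :=
      Subtype.ext (Prod.ext rfl (himp_self))
    rw [h, one_mul, OrderIso.symm_apply_apply]
  mul_one p := by
    show (delta A).symm (delta A p * delta A ⟨(⊤, A.f), _⟩) = p
    have h : delta A ⟨(⊤, A.f), by simp, by simp⟩ = 1 :=
      Subtype.ext (Prod.ext rfl (himp_self))
    rw [h, mul_one, OrderIso.symm_apply_apply]
  imp p q := (delta A).symm (imp (delta A p) (delta A q))
  mul_le_iff p q r := by
    show (delta A).symm (delta A p * delta A q) ≤ r ↔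
      p ≤ (delta A).symm (imp (delta A q) (delta A r))
    rw [OrderIso.symm_apply_le, OrderIso.le_symm_apply, mul_le_iff]
  inf_sup_distrib p q r := Subtype.ext (Prod.ext (inf_sup_left _ _ _) (sup_inf_left _ _ _))
  mul_idem p := by
    show (delta A).symm (delta A p * delta A p) = p
    rw [OrderIso.symm_apply_eq]
    exact Subtype.ext (A.semilinear.mul_self (delta A p).2)
  invol p := ⟨p.1.swap, p.2.swap⟩
  invol_invol _ := rfl
  imp_invol p q := by
    show (delta A).symm (imp (delta A p) (delta A ⟨q.1.swap, q.2.swap⟩)) =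
      (delta A).symm (imp (delta A q) (delta A ⟨p.1.swap, p.2.swap⟩))
    rw [← delta_invol, ← delta_invol, crl_imp_imp, crl_imp_imp, _root_.mul_comm]

/-- The object part of `(-)^⋈`. -/
def twistObj (A : BRSA.{u}) : SM.{u} where
  carrier := Twist A

theorem BRSA.Hom.isTwist {A B : BRSA.{u}} (h : BRSA.Hom A B) {p : A.carrier × A.carrier}
    (hp : IsTwist A.f p) : IsTwist B.f (h.toFun p.1, h.toFun p.2) :=
  ⟨by show h.toFun p.1 ⊔ h.toFun p.2 = ⊤; rw [← h.map_sup, hp.1, h.map_top],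
    by
      show h.toFun p.1 ⊓ h.toFun p.2 ≤ B.f
      rw [← h.map_inf, ← h.map_f, ← inf_eq_left, ← h.map_inf, inf_eq_left.2 hp.2]⟩

theorem BRSA.Hom.isBrouwerianHom {A B : BRSA.{u}} (h : BRSA.Hom A B) :
    IsBrouwerianHom h.toFun :=
  ⟨h.map_inf, h.map_sup, h.map_himp, h.map_top⟩

theorem BRSA.Hom.map_deltaInv {A B : BRSA.{u}} (h : BRSA.Hom A B) {p : SigmaTwist A}
    {q : SigmaTwist B} (hpq : Prod.map h.toFun h.toFun p.1 = q.1) :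
    Prod.map h.toFun h.toFun ((delta A).symm p).1 = ((delta B).symm q).1 := by
  obtain ⟨q, hq⟩ := q
  obtain rfl : Prod.map h.toFun h.toFun p.1 = q := hpq
  refine Prod.ext rfl ?_
  show h.toFun (p.1.2 ⊓ (p.1.1 ⇨ A.f)) = h.toFun p.1.2 ⊓ (h.toFun p.1.1 ⇨ B.f)
  rw [h.map_inf, h.map_himp, h.map_f]

theorem BRSA.Hom.map_delta {A B : BRSA.{u}} (h : BRSA.Hom A B) (p : Twist A) :
    Prod.map h.toFun h.toFun (delta A p).1 =
      (delta B ⟨(h.toFun p.1.1, h.toFun p.1.2), h.isTwist p.2⟩).1 :=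
  Prod.ext rfl (by
    show h.toFun (A.f ⇨ p.1.2) = B.f ⇨ h.toFun p.1.2
    rw [h.map_himp, h.map_f])

/-- The map `⟨a, b⟩ ↦ ⟨h a, h b⟩`. -/
def twistMap {A B : BRSA.{u}} (h : BRSA.Hom A B) : SM.Hom (twistObj A) (twistObj B) where
  toFun (p : Twist A) := (⟨(h.toFun p.1.1, h.toFun p.1.2), h.isTwist p.2⟩ : Twist B)
  map_inf _ _ := Subtype.ext (Prod.ext (h.map_inf _ _) (h.map_sup _ _))
  map_sup _ _ := Subtype.ext (Prod.ext (h.map_sup _ _) (h.map_inf _ _))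
  map_mul p q := Subtype.ext (h.map_deltaInv
    ((h.isBrouwerianHom.map_mul A.f (delta A p).1 (delta A q).1).trans (by
      rw [h.map_f, h.map_delta p, h.map_delta q]
      rfl)))
  map_imp p q := Subtype.ext (h.map_deltaInv
    ((h.isBrouwerianHom.map_imp A.f (delta A p).1 (delta A q).1).trans (by
      rw [h.map_f, h.map_delta p, h.map_delta q]
      rfl)))
  map_one := Subtype.ext (Prod.ext h.map_top h.map_f)
  map_invol _ := rfl

/-- The functor `(-)^⋈ : bRSA ⥤ SM`. -/
def twist : BRSA.{u} ⥤ SM.{u} where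
  obj := twistObj
  map := twistMap

/-- The functor `(-)^⋈` between the bounded categories; the least element is `⟨bot, ⊤⟩`. -/
def twistBot : BGA.{u} ⥤ SMBot.{u} where
  obj A :=
    { twistObj A.toBRSA with
      bot := (⟨(A.bot, ⊤), by simp, by simpa using A.bot_le A.f⟩ : Twist A.toBRSA)
      bot_le := fun p => ⟨A.bot_le p.1.1, le_top⟩ }
  map h :=
    { twistMap h.toHom with
      map_bot := Subtype.ext (Prod.ext h.map_bot h.map_top) }

/-! Both composites of the two functors are computed on elements, and in each case the component of
the natural isomorphism is an explicit homomorphism with an explicit inverse map.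

For a bRS-algebra, a pair `⟨a, b⟩` of `A^⋈` lies below the identity `⟨⊤, f⟩` exactly when `f ≤ b`.
Together with `a ⊔ b = ⊤` and `a ⊓ b ≤ f` this forces `b = a ⇨ f` (`IsTwist.snd_eq_himp`).
Conversely `⟨a, a ⇨ f⟩` always belongs to `A^⋈`, because `a ⊔ (a ⇨ f) = ⊤`. So the first projection
identifies the negative cone of `A^⋈` with `A`.

For a Sugihara monoid, an element `a` has the coordinates `a ⊓ 1` and `¬ a ⊓ 1`. They form a pair of
the twist product since `1 ≤ a ⊔ ¬ a` and `a * ¬ a ≤ ¬ 1`, and they recover `a` as `(a ⊓ 1) * ¬ (¬ a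
⊓ 1)` (`inf_one_mul_sup_invol_one`). Lattice operations and involution are respected by
distributivity and De Morgan, and the product is `¬ (a → ¬ b)`, so only the residual is difficult.
After `δ` the coordinates are `a ⊓ 1` and `(a → 1) ⊓ 1`. Testing both sides of the residual formula
against `z ≤ 1` leaves two equivalences between inequalities in the monoid, `mul_le_iff_coordinates`
and `mul_imp_le_one_iff_coordinates`. Their main tools are idempotence, `(a ⊓ 1) * a = a`, and `a ≤
b ↔ a * ¬ b ≤ ¬ 1`. -/

/-! ## Isomorphisms from invertible homomorphisms -/

/-- Bijective homomorphisms of algebras are isomorphisms; this is the argument for one binary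
operation, reused for each operation in each of the signatures. -/
theorem hom_inverse₂ {α β : Type u} {h : α → β} {g : β → α} (hg : Function.LeftInverse g h)
    (gh : Function.RightInverse g h) {o : α → α → α} {o' : β → β → β}
    (H : ∀ a b, h (o a b) = o' (h a) (h b)) (x y : β) : g (o' x y) = o (g x) (g y) := by
  rw [← hg (o (g x) (g y)), H, gh, gh]

/-- A homomorphism with an inverse map is an isomorphism of `bRSA`. -/
def BRSA.isoOfInverse {A B : BRSA.{u}} (h : BRSA.Hom A B) (g : B.carrier → A.carrier)
    (hg : Function.LeftInverse g h.toFun) (gh : Function.RightInverse g h.toFun) : A ≅ B where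
  hom := h
  inv := show BRSA.Hom B A from
    { toFun := g
      map_inf := hom_inverse₂ hg gh h.map_inf
      map_sup := hom_inverse₂ hg gh h.map_sup
      map_himp := hom_inverse₂ hg gh h.map_himp
      map_top := by rw [← h.map_top, hg]
      map_f := by rw [← h.map_f, hg] }
  hom_inv_id := BRSA.Hom.ext (funext hg)
  inv_hom_id := BRSA.Hom.ext (funext gh)

/-- A homomorphism with an inverse map is an isomorphism of `bGA`. -/
def BGA.isoOfInverse {A B : BGA.{u}} (h : BGA.Hom A B) (g : B.carrier → A.carrier)
    (hg : Function.LeftInverse g h.toFun) (gh : Function.RightInverse g h.toFun) : A ≅ B where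
  hom := h
  inv := show BGA.Hom B A from
    { (BRSA.isoOfInverse h.toHom g hg gh).inv with
      map_bot := by
        show g B.bot = A.bot
        rw [← h.map_bot, hg] }
  hom_inv_id := BGA.Hom.ext (funext hg)
  inv_hom_id := BGA.Hom.ext (funext gh)

/-- A homomorphism with an inverse map is an isomorphism of `SM`. -/
def SM.isoOfInverse {A B : SM.{u}} (h : SM.Hom A B) (g : B.carrier → A.carrier)
    (hg : Function.LeftInverse g h.toFun) (gh : Function.RightInverse g h.toFun) : A ≅ B where
  hom := h
  inv := show SM.Hom B A from
    { toFun := g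
      map_inf := hom_inverse₂ hg gh h.map_inf
      map_sup := hom_inverse₂ hg gh h.map_sup
      map_mul := hom_inverse₂ hg gh h.map_mul
      map_imp := hom_inverse₂ hg gh h.map_imp
      map_one := by rw [← h.map_one, hg]
      map_invol := fun x => by rw [← hg (invol (g x)), h.map_invol, gh] }
  hom_inv_id := SM.Hom.ext (funext hg)
  inv_hom_id := SM.Hom.ext (funext gh)

/-- A homomorphism with an inverse map is an isomorphism of `SM_⊥`. -/
def SMBot.isoOfInverse {A B : SMBot.{u}} (h : SMBot.Hom A B) (g : B.carrier → A.carrier)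
    (hg : Function.LeftInverse g h.toFun) (gh : Function.RightInverse g h.toFun) : A ≅ B where
  hom := h
  inv := show SMBot.Hom B A from
    { (SM.isoOfInverse h.toHom g hg gh).inv with
      map_bot := by
        show g B.bot = A.bot
        rw [← h.map_bot, hg] }
  hom_inv_id := SMBot.Hom.ext (funext hg)
  inv_hom_id := SMBot.Hom.ext (funext gh)

/-! ## The negative cone of the twist product -/

/-- The elements of the negative cone of `A^⋈` are the pairs `⟨a, a ⇨ f⟩`. -/
theorem IsTwist.snd_eq_himp {A : Type u} [GeneralizedHeytingAlgebra A] {f : A} {p : A × A}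
    (hp : IsTwist f p) (hf : f ≤ p.2) : p.2 = p.1 ⇨ f := by
  refine le_antisymm (le_himp_iff.2 (by rw [inf_comm]; exact hp.2)) ?_
  -- Splitting along `p.1 ⊔ p.2 = ⊤`: the part inside `p.1` falls below `f`, hence below `p.2`.
  calc p.1 ⇨ f = (p.1 ⇨ f) ⊓ (p.1 ⊔ p.2) := by rw [hp.1, inf_top_eq]
    _ = (p.1 ⇨ f) ⊓ p.1 ⊔ (p.1 ⇨ f) ⊓ p.2 := inf_sup_left _ _ _
    _ ≤ p.2 := sup_le (himp_inf_le.trans hf) inf_le_right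

/-- The first projection from the negative cone of `A^⋈` to `A`. -/
def negConeTwistFst (A : BRSA.{u}) : BRSA.Hom (negConeObj (twistObj A)) A where
  toFun (p : NegCone (Twist A)) := p.1.1.1
  map_inf _ _ := rfl
  map_sup _ _ := rfl
  map_himp := by
    rintro (p : NegCone (Twist A)) (q : NegCone (Twist A))
    -- The last `⊤` is the first coordinate of the monoid identity, coming from `(p → q) ⊓ 1`. The
    -- middle factor is trivial: `p` is in the negative cone, so `f` is below its second coordinate
    -- and `δ` sends that coordinate to `⊤`.
    show (p.1.1.1 ⇨ q.1.1.1) ⊓ ((A.f ⇨ q.1.1.2) ⇨ (A.f ⇨ p.1.1.2)) ⊓ ⊤ = p.1.1.1 ⇨ q.1.1.1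
    have h : A.f ≤ p.1.1.2 := p.2.2
    rw [himp_eq_top_iff.2 h, himp_top, inf_top_eq, inf_top_eq]
  map_top := rfl
  map_f := rfl

/-- The map `a ↦ ⟨a, a ⇨ f⟩`. -/
def toNegConeTwist (A : BRSA.{u}) (a : A.carrier) : NegCone (Twist A) :=
  ⟨⟨(a, a ⇨ A.f), A.sup_himp a, inf_himp_le⟩, le_top, le_himp⟩

theorem toNegConeTwist_fst (A : BRSA.{u}) :
    Function.LeftInverse (toNegConeTwist A) (negConeTwistFst A).toFun :=
  fun (p : NegCone (Twist A)) =>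
    Subtype.ext (Subtype.ext (Prod.ext rfl (p.1.2.snd_eq_himp p.2.2).symm))

/-- The natural isomorphism `(A^⋈)_⋈ ≅ A`. -/
def negConeTwistIso : twist.{u} ⋙ negCone.{u} ≅ 𝟭 BRSA.{u} :=
  NatIso.ofComponents
    (fun A => BRSA.isoOfInverse (negConeTwistFst A) (toNegConeTwist A) (toNegConeTwist_fst A)
      fun _ => rfl)
    fun _ => rfl

/-- The natural isomorphism `(A^⋈)_⋈ ≅ A` between the bounded categories. -/
def negConeTwistBotIso : twistBot.{u} ⋙ negConeBot.{u} ≅ 𝟭 BGA.{u} :=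
  NatIso.ofComponents
    (fun A => BGA.isoOfInverse { negConeTwistFst A.toBRSA with map_bot := rfl }
      (toNegConeTwist A.toBRSA) (toNegConeTwist_fst A.toBRSA) fun _ => rfl)
    fun _ => rfl

/-! ## The twist product of the negative cone -/

section SugiharaMonoid

variable {A : Type u}

theorem crl_sup_mul [CommResiduatedLattice A] (a b c : A) : (a ⊔ b) * c = a * c ⊔ b * c :=
  eq_of_forall_ge_iff fun x => by simp only [mul_le_iff, sup_le_iff]

variable [SugiharaMonoid A]

theorem imp_eq_invol_mul (a b : A) : imp a b = invol (a * invol b) := by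
  rw [← invol_imp, invol_invol]

theorem mul_eq_invol_imp (a b : A) : a * b = invol (imp a (invol b)) := by
  rw [invol_imp, invol_invol]

/-- Residuation with `¬ b → ¬ 1 = b`. Every inequality becomes a bound on a product, whose factors
may then be permuted and duplicated freely. -/
theorem le_iff_mul_invol_le {a b : A} : a ≤ b ↔ a * invol b ≤ invol 1 := by
  rw [mul_le_iff, imp_invol_one, invol_invol]

theorem invol_sup (a b : A) : invol (a ⊔ b) = invol a ⊓ invol b := by
  refine le_antisymm (le_inf (invol_anti le_sup_left) (invol_anti le_sup_right)) ?_
  rw [← invol_invol (invol a ⊓ invol b)]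
  refine invol_anti (sup_le ?_ ?_)
  · simpa only [invol_invol] using invol_anti (inf_le_left : invol a ⊓ invol b ≤ _)
  · simpa only [invol_invol] using invol_anti (inf_le_right : invol a ⊓ invol b ≤ _)

theorem invol_inf (a b : A) : invol (a ⊓ b) = invol a ⊔ invol b := by
  rw [← invol_invol (invol a ⊔ invol b), invol_sup, invol_invol, invol_invol]

theorem sugihara_sup_inf (a b c : A) : (a ⊔ b) ⊓ c = (a ⊓ c) ⊔ (b ⊓ c) := by
  rw [inf_comm, inf_sup_distrib, inf_comm c, inf_comm c]

/-! ### Recovering an element from the coordinates `a ⊓ 1` and `¬ a ⊓ 1`. -/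

theorem inf_one_sup_invol_inf_one (a : A) : (a ⊓ 1) ⊔ (invol a ⊓ 1) = 1 := by
  rw [← sugihara_sup_inf, inf_eq_right]
  exact one_le_sup_invol a

theorem mul_le_of_le_one {a z : A} (hz : z ≤ 1) : z * a ≤ a := by
  simpa using crl_mul_mono hz (le_refl a)

theorem mul_le_of_le_one' {a z : A} (hz : z ≤ 1) : a * z ≤ a := by
  simpa using crl_mul_mono (le_refl a) hz

/-- The two coordinates join to `1`, so `a` is the join of its products with them. The product with
`¬ a ⊓ 1` contributes nothing new: it is below `a` and below `¬ 1 ≤ 1`, hence below `a ⊓ 1 = (a ⊓ 1)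
* (a ⊓ 1)`. -/
theorem inf_one_mul_self (a : A) : (a ⊓ 1) * a = a := by
  refine le_antisymm (mul_le_of_le_one inf_le_right) ?_
  calc a = ((a ⊓ 1) ⊔ (invol a ⊓ 1)) * a := by rw [inf_one_sup_invol_inf_one, one_mul]
    _ = (a ⊓ 1) * a ⊔ (invol a ⊓ 1) * a := crl_sup_mul _ _ _
    _ ≤ (a ⊓ 1) * a := sup_le le_rfl ?_
  calc (invol a ⊓ 1) * a ≤ a ⊓ 1 := by
        refine le_inf (mul_le_of_le_one inf_le_right) ?_
        refine (crl_mul_mono inf_le_left le_rfl).trans ?_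
        rw [_root_.mul_comm]
        exact (mul_invol_le a).trans invol_one_le
    _ = (a ⊓ 1) * (a ⊓ 1) := (mul_idem _).symm
    _ ≤ (a ⊓ 1) * a := crl_mul_mono le_rfl inf_le_left

/-- By De Morgan the second factor is `a ⊔ ¬ 1`. Its `a` part gives `a` by `inf_one_mul_self`, and
its `¬ 1` part gives something below `a ⊓ 1`. -/
theorem inf_one_mul_sup_invol_one (a : A) : (a ⊓ 1) * invol (invol a ⊓ 1) = a := by
  rw [invol_inf, invol_invol, _root_.mul_comm, crl_sup_mul, _root_.mul_comm a, inf_one_mul_self]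
  exact sup_eq_left.2 ((mul_le_of_le_one invol_one_le).trans inf_le_left)

/-! ### Inequalities for the residual, expressed through coordinates. -/

theorem mul_invol_self_le (a : A) : a * invol a ≤ a := by
  rw [le_iff_mul_invol_le, _root_.mul_assoc, mul_idem]
  exact mul_invol_le a

/-- The residual absorbs `¬ a`, and by `imp_mul_le` also `b`. This is how a bound on `z * (a → b)`
yields separate bounds concerning `a` and `b` in `mul_imp_le_one_iff_coordinates`. -/
theorem imp_mul_invol_le (a b : A) : imp a b * invol a ≤ imp a b := by
  rw [← mul_le_iff]
  calc imp a b * invol a * a = a * invol a * imp a b := by ac_rfl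
    _ ≤ a * imp a b := crl_mul_mono (mul_invol_self_le a) le_rfl
    _ ≤ b := crl_mul_imp_le a b

theorem imp_mul_le (a b : A) : imp a b * b ≤ imp a b := by
  rw [← mul_le_iff]
  calc imp a b * b * a = a * imp a b * b := by ac_rfl
    _ ≤ b * b := crl_mul_mono (crl_mul_imp_le a b) le_rfl
    _ = b := mul_idem b

theorem le_one_iff_mul_invol_one_le {a : A} : a ≤ 1 ↔ a * invol 1 ≤ invol 1 := le_iff_mul_invol_le

/-- The inequality `z ≤ a → b` in terms of the coordinates of `a` and `b`. -/
theorem mul_le_iff_coordinates (z a b : A) :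
    z * a ≤ b ↔ z * (a ⊓ 1) ≤ b ∧ z * (imp b 1 ⊓ 1) * a ≤ 1 := by
  constructor
  · intro h
    refine ⟨(crl_mul_mono le_rfl inf_le_left).trans h, ?_⟩
    calc z * (imp b 1 ⊓ 1) * a = (imp b 1 ⊓ 1) * (z * a) := by ac_rfl
      _ ≤ imp b 1 * b := crl_mul_mono inf_le_left h
      _ ≤ 1 := by rw [_root_.mul_comm]; exact crl_mul_imp_le b 1
  · rintro ⟨h1, h2⟩
    -- Since `b → 1 = ¬ (b * ¬ 1)` and `b * ¬ 1 ≤ b`, the element `¬ b` lies below `b → 1`.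
    have h3 : invol b ⊓ 1 ≤ imp b 1 ⊓ 1 := by
      refine inf_le_inf_right _ ?_
      rw [imp_eq_invol_mul]
      exact invol_anti (mul_le_of_le_one' invol_one_le)
    rw [le_iff_mul_invol_le]
    -- Each of `z`, `a`, `¬ b` is duplicated so that the product regroups into one factor controlled
    -- by each hypothesis: the first is at most `¬ 1`, the second at most `1`.
    calc z * a * invol b = (z * z) * ((a ⊓ 1) * a) * ((invol b ⊓ 1) * invol b) := by
          rw [inf_one_mul_self, inf_one_mul_self, mul_idem]
      _ = (z * (a ⊓ 1) * invol b) * (z * (invol b ⊓ 1) * a) := by ac_rfl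
      _ ≤ invol 1 * 1 := crl_mul_mono (le_iff_mul_invol_le.1 (by simpa only [invol_invol] using h1))
          ((crl_mul_mono (crl_mul_mono le_rfl h3) le_rfl).trans h2)
      _ = invol 1 := mul_one _

/-- The inequality `z ≤ (a → b) → 1` in terms of the coordinates of `a` and `b`. -/
theorem mul_imp_le_one_iff_coordinates (z a b : A) :
    z * imp a b ≤ 1 ↔
      z * invol 1 * (imp a b ⊓ 1) ≤ a ∧ z * invol 1 * (imp a b ⊓ 1) * b ≤ 1 := by
  constructor
  · intro h
    -- The hypothesis is sharpened to `z * (a → b) * ¬ 1 ≤ ¬ 1`, which supplies the factor `¬ 1`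
    -- occurring in both conclusions.
    rw [le_one_iff_mul_invol_one_le] at h
    constructor
    · rw [le_iff_mul_invol_le]
      calc z * invol 1 * (imp a b ⊓ 1) * invol a ≤ z * invol 1 * imp a b * invol a :=
            crl_mul_mono (crl_mul_mono le_rfl inf_le_left) le_rfl
        _ = z * invol 1 * (imp a b * invol a) := _root_.mul_assoc _ _ _
        _ ≤ z * invol 1 * imp a b := crl_mul_mono le_rfl (imp_mul_invol_le a b)
        _ = z * imp a b * invol 1 := mul_right_comm _ _ _
        _ ≤ invol 1 := h
    · calc z * invol 1 * (imp a b ⊓ 1) * b ≤ z * invol 1 * imp a b * b :=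
            crl_mul_mono (crl_mul_mono le_rfl inf_le_left) le_rfl
        _ = z * invol 1 * (imp a b * b) := _root_.mul_assoc _ _ _
        _ ≤ z * invol 1 * imp a b := crl_mul_mono le_rfl (imp_mul_le a b)
        _ = z * imp a b * invol 1 := mul_right_comm _ _ _
        _ ≤ 1 := h.trans invol_one_le
  · rintro ⟨h1, h2⟩
    set i := imp a b with hi
    -- Writing `i = (i ⊓ 1) * i`, the first hypothesis yields a factor `a`, and the remaining `i = a
    -- → b` turns it into `b`.
    have h3 : z * invol 1 * i ≤ b := by
      calc z * invol 1 * i = z * invol 1 * ((i ⊓ 1) * i) := by rw [inf_one_mul_self]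
        _ = z * invol 1 * (i ⊓ 1) * i := (_root_.mul_assoc _ _ _).symm
        _ ≤ a * i := crl_mul_mono h1 le_rfl
        _ ≤ b := crl_mul_imp_le a b
    have h4 : z * invol 1 * i ≤ 1 := by
      -- Duplicating every factor leaves one copy of `z * ¬ 1 * i` to be bounded by `b` through
      -- `h3`, and the other copy, with `i ⊓ 1`, meets the second hypothesis.
      calc z * invol 1 * i = (z * z) * (invol 1 * invol 1) * ((i ⊓ 1) * i) := by
            rw [inf_one_mul_self, mul_idem, mul_idem]
        _ = z * invol 1 * (i ⊓ 1) * (z * invol 1 * i) := by ac_rfl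
        _ ≤ z * invol 1 * (i ⊓ 1) * b := crl_mul_mono le_rfl h3
        _ ≤ 1 := h2
    rw [le_one_iff_mul_invol_one_le]
    calc z * i * invol 1 = z * i * (invol 1 * invol 1) := by rw [mul_idem]
      _ = z * invol 1 * i * invol 1 := by ac_rfl
      _ ≤ 1 * invol 1 := crl_mul_mono h4 le_rfl
      _ = invol 1 := one_mul _

/-! ### Testing identities in the negative cone by the elements below. -/

/-- The element `a ⊓ 1` of the negative cone. -/
def toNegCone (a : A) : NegCone A := ⟨a ⊓ 1, inf_le_right⟩

/-- The element `¬ 1` of the negative cone. -/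
def involOne (A : Type u) [SugiharaMonoid A] : NegCone A := ⟨invol 1, invol_one_le⟩

theorem le_toNegCone_iff {z : NegCone A} {a : A} : z ≤ toNegCone a ↔ z.1 ≤ a :=
  le_inf_iff.trans (and_iff_left z.2)

/-- An element of the cone is determined by the cone elements below it. This turns identities
between Brouwerian terms into inequalities of the monoid, where residuation applies. -/
theorem toNegCone_eq_iff {a : A} {x : NegCone A} : toNegCone a = x ↔ ∀ z : NegCone A, z.1 ≤ a ↔ z ≤ x :=
  ⟨fun h z => by rw [← h, le_toNegCone_iff], fun h => eq_of_forall_le_iff fun z => by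
    rw [le_toNegCone_iff, h]⟩

theorem val_inf_eq_mul (x y : NegCone A) : (x ⊓ y).1 = x.1 * y.1 := (mul_eq_inf x.2 y.2).symm

theorem le_himp_toNegCone_iff {z x : NegCone A} {a : A} : z ≤ x ⇨ toNegCone a ↔ z.1 * x.1 ≤ a := by
  rw [le_himp_iff, le_toNegCone_iff, val_inf_eq_mul]

end SugiharaMonoid

/-! ### The isomorphism of a Sugihara monoid with the twist product of its negative cone. -/

/-- The pair `⟨a ⊓ 1, ¬ a ⊓ 1⟩`. -/
def toTwistNegCone (A : SM.{u}) (a : A.carrier) : Twist (negConeObj A) :=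
  ⟨((toNegCone a : NegCone A.carrier), (toNegCone (invol a) : NegCone A.carrier)),
    Subtype.ext (inf_one_sup_invol_inf_one a), by
      show ((toNegCone a : NegCone A.carrier) ⊓ toNegCone (invol a)).1 ≤ invol 1
      rw [val_inf_eq_mul]
      exact (crl_mul_mono inf_le_left inf_le_left).trans (mul_invol_le a)⟩

/-- For `z ≤ 1`, `z * ¬ 1 ≤ ¬ a` says `z ≤ ¬ 1 → ¬ a = a → 1`. The nucleus thus disappears from the
second coordinate before the residual formula is applied. -/
theorem delta_toTwistNegCone (A : SM.{u}) (a : A.carrier) :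
    (delta (negConeObj A) (toTwistNegCone A a)).1 =
      ((toNegCone a : NegCone A.carrier), (toNegCone (imp a 1) : NegCone A.carrier)) := by
  refine Prod.ext rfl (Eq.symm (toNegCone_eq_iff.2 fun z => ?_))
  show z.1 ≤ imp a 1 ↔ z ≤ involOne A.carrier ⇨ toNegCone (invol a)
  rw [le_himp_toNegCone_iff, show (involOne A.carrier).1 = invol 1 from rfl,
    mul_le_iff, imp_invol, invol_invol]

/-- The one operation that needs real work. The equation is compared in `Σ`, where the residual has
its explicit formula, and each coordinate is tested against the elements `z` of the cone; what
remains is exactly one of the two coordinate lemmas. -/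
theorem toTwistNegCone_imp (A : SM.{u}) (a b : A.carrier) :
    toTwistNegCone A (imp a b) = imp (toTwistNegCone A a) (toTwistNegCone A b) := by
  refine (OrderIso.eq_symm_apply (delta (negConeObj A))).2 (Subtype.ext ?_)
  show _ = pairImp (negConeObj A).f (delta (negConeObj A) (toTwistNegCone A a)).1
    (delta (negConeObj A) (toTwistNegCone A b)).1
  simp only [delta_toTwistNegCone, pairImp]
  have h1 : (toNegCone (imp a b) : NegCone A.carrier) =
      (toNegCone a ⇨ toNegCone b) ⊓ (toNegCone (imp b 1) ⇨ toNegCone (imp a 1)) :=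
    toNegCone_eq_iff.2 fun z => by
      rw [le_inf_iff, le_himp_toNegCone_iff, le_himp_toNegCone_iff, ← mul_le_iff, ← mul_le_iff]
      exact mul_le_iff_coordinates z.1 a b
  refine Prod.ext h1 ?_
  have h2 : (toNegCone (imp (imp a b) 1) : NegCone A.carrier) =
      involOne A.carrier ⇨ (toNegCone (imp a b) ⇨ (toNegCone a ⊓ toNegCone (imp b 1))) :=
    toNegCone_eq_iff.2 fun z => by
      -- Currying merges the two antecedents into the product `¬ 1 * ((a → b) ⊓ 1)`, and the meet in
      -- the consequent gives the two conjuncts.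
      rw [himp_himp, himp_inf_distrib, le_inf_iff, le_himp_toNegCone_iff, le_himp_toNegCone_iff,
        val_inf_eq_mul, show (involOne A.carrier).1 = invol 1 from rfl, ← _root_.mul_assoc, ← mul_le_iff, ← mul_le_iff]
      exact mul_imp_le_one_iff_coordinates z.1 a b
  exact h2.trans (by rw [h1]; rfl)

theorem toTwistNegCone_invol (A : SM.{u}) (a : A.carrier) :
    toTwistNegCone A (invol a) = invol (toTwistNegCone A a) :=
  Subtype.ext (Prod.ext rfl (congrArg toNegCone (invol_invol a)))

/-- The homomorphism `a ↦ ⟨a ⊓ 1, ¬ a ⊓ 1⟩`. -/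
def twistNegConeHom (A : SM.{u}) : SM.Hom A (twistObj (negConeObj A)) where
  toFun := toTwistNegCone A
  map_inf a b := Subtype.ext (Prod.ext
    (Subtype.ext (inf_inf_distrib_right a b 1))
    (Subtype.ext (by
      show invol (a ⊓ b) ⊓ 1 = (invol a ⊓ 1) ⊔ (invol b ⊓ 1)
      rw [invol_inf, sugihara_sup_inf])))
  map_sup a b := Subtype.ext (Prod.ext
    (Subtype.ext (sugihara_sup_inf a b 1))
    (Subtype.ext (by
      show invol (a ⊔ b) ⊓ 1 = (invol a ⊓ 1) ⊓ (invol b ⊓ 1)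
      rw [invol_sup, inf_inf_distrib_right])))
  map_mul a b := by
    show toTwistNegCone A (a * b) = toTwistNegCone A a * toTwistNegCone A b
    -- `a * b = ¬ (a → ¬ b)` holds in both Sugihara monoids, so preservation of residual and
    -- involution suffices.
    rw [mul_eq_invol_imp a, toTwistNegCone_invol, toTwistNegCone_imp, toTwistNegCone_invol,
      ← mul_eq_invol_imp]
  map_imp := toTwistNegCone_imp A
  map_one := Subtype.ext (Prod.ext
    (Subtype.ext (inf_idem 1))
    (Subtype.ext (inf_eq_left.2 invol_one_le)))
  map_invol := toTwistNegCone_invol A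

/-- The map `⟨x, y⟩ ↦ x * ¬ y`. -/
def ofTwistNegCone (A : SM.{u}) (p : Twist (negConeObj A)) : A.carrier :=
  Subtype.val (p := (· ≤ (1 : A.carrier))) p.1.1 *
    invol (Subtype.val (p := (· ≤ (1 : A.carrier))) p.1.2)

theorem ofTwistNegCone_toTwistNegCone (A : SM.{u}) :
    Function.LeftInverse (ofTwistNegCone A) (toTwistNegCone A) :=
  inf_one_mul_sup_invol_one

theorem toTwistNegCone_ofTwistNegCone (A : SM.{u}) :
    Function.RightInverse (ofTwistNegCone A) (toTwistNegCone A) := by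
  rintro ⟨⟨⟨x, hx⟩, ⟨y, hy⟩⟩, h1, h2⟩
  replace h1 : x ⊔ y = 1 := congrArg Subtype.val h1
  replace h2 : x * y ≤ invol 1 := (mul_eq_inf hx hy).trans_le h2
  -- Because `x ⊔ y = 1`, an upper bound for `z` may be checked separately for `x * z` and `y * z`;
  -- both coordinates are bounded above this way.
  have split : ∀ z : A.carrier, z = x * z ⊔ y * z := fun z => by rw [← crl_sup_mul, h1, one_mul]
  refine Subtype.ext (Prod.ext (Subtype.ext ?_) (Subtype.ext ?_))
  · show x * invol y ⊓ 1 = x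
    refine le_antisymm ?_ (le_inf ?_ hx)
    · rw [split (x * invol y ⊓ 1)]
      refine sup_le (mul_le_of_le_one' inf_le_right) ?_
      calc y * (x * invol y ⊓ 1) ≤ y * (x * invol y) := crl_mul_mono le_rfl inf_le_left
        _ = x * (y * invol y) := mul_left_comm _ _ _
        _ ≤ x * 1 := crl_mul_mono le_rfl ((mul_invol_le y).trans invol_one_le)
        _ = x := mul_one x
    -- The condition `x ⊓ y ≤ f` of the twist product is precisely `x ≤ ¬ y`.
    · have h3 : x ≤ invol y := by rw [le_iff_mul_invol_le, invol_invol]; exact h2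
      calc x = x * x := (mul_idem x).symm
        _ ≤ x * invol y := crl_mul_mono le_rfl h3
  · show invol (x * invol y) ⊓ 1 = y
    rw [← imp_eq_invol_mul]
    refine le_antisymm ?_ (le_inf ((mul_le_iff _ _ _).1 (mul_le_of_le_one' hx)) hy)
    rw [split (imp x y ⊓ 1)]
    exact sup_le ((crl_mul_mono le_rfl inf_le_left).trans (crl_mul_imp_le x y))
      (mul_le_of_le_one' inf_le_right)

theorem toTwistNegCone_natural {A B : SM.{u}} (h : SM.Hom A B) (a : A.carrier) :
    toTwistNegCone B (h.toFun a) =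
      (twistMap (negConeMap h)).toFun (toTwistNegCone A a) :=
  Subtype.ext (Prod.ext
    (Subtype.ext (by
      show h.toFun a ⊓ 1 = h.toFun (a ⊓ 1)
      rw [h.map_inf, h.map_one]))
    (Subtype.ext (by
      show invol (h.toFun a) ⊓ 1 = h.toFun (invol a ⊓ 1)
      rw [h.map_inf, h.map_one, h.map_invol])))

/-- The natural isomorphism `A ≅ (A_⋈)^⋈`. -/
def twistNegConeIso : 𝟭 SM.{u} ≅ negCone.{u} ⋙ twist.{u} :=
  NatIso.ofComponents
    (fun A => SM.isoOfInverse (twistNegConeHom A) (ofTwistNegCone A)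
      (ofTwistNegCone_toTwistNegCone A) (toTwistNegCone_ofTwistNegCone A))
    fun h => SM.Hom.ext (funext (toTwistNegCone_natural h))

theorem toTwistNegCone_bot (A : SMBot.{u}) :
    toTwistNegCone A.toSM A.bot = (twistBot.obj (negConeBot.obj A)).bot :=
  Subtype.ext (Prod.ext
    (Subtype.ext (inf_eq_left.2 (A.bot_le 1)))
    -- `¬ ⊥` lies above `1` because `⊥ ≤ ¬ 1`, so the second coordinate is the top of the cone.
    (Subtype.ext (inf_eq_right.2 (one_le_of_invol_le (by
      rw [invol_invol]; exact A.bot_le _)))))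

/-- The natural isomorphism `A ≅ (A_⋈)^⋈` between the bounded categories. -/
def twistNegConeBotIso : 𝟭 SMBot.{u} ≅ negConeBot.{u} ⋙ twistBot.{u} :=
  NatIso.ofComponents
    (fun A => SMBot.isoOfInverse
      { twistNegConeHom A.toSM with map_bot := toTwistNegCone_bot A } (ofTwistNegCone A.toSM)
      (ofTwistNegCone_toTwistNegCone A.toSM) (toTwistNegCone_ofTwistNegCone A.toSM))
    fun h => SMBot.Hom.ext (funext (toTwistNegCone_natural h.toHom))

theorem mainTheorem4 :
    (∃ e : BRSA.{u} ≌ SM.{u}, e.functor = twist.{u} ∧ e.inverse = negCone.{u}) ∧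
    (∃ e : BGA.{u} ≌ SMBot.{u}, e.functor = twistBot.{u} ∧ e.inverse = negConeBot.{u}) :=
  -- No triangle identity has to be checked: the unit is corrected to satisfy it, while both
  -- functors remain literally the given ones.
  ⟨⟨.mk twist negCone negConeTwistIso.symm twistNegConeIso.symm, rfl, rfl⟩,
    ⟨.mk twistBot negConeBot negConeTwistBotIso.symm twistNegConeBotIso.symm, rfl, rfl⟩⟩
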